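/- Let $G$ be a connected and simply connected compact Lie group with simple Lie algebra $\mathcal G$, let $\langle\cdot,\cdot\rangle$ be a positive multiple of the Killing form of $\mathcal G$ (it is negative definite), let $G_0<G$ be a maximal torus with Lie algebra $\mathcal G_0$, and let $\mathcal G=\mathcal G_0+\mathcal G_\perp$ be the orthogonal decomposition, $X=X_0+X_\perp$. An element of $G$ is regular if its centralizer in $G$ is a maximal torus; $G^{\rm reg}$ is the open set of regular elements and $G_0^{\rm reg}=G_0\cap G^{\rm reg}$. For $Q\in G_0^{\rm reg}$ put $$\mathcal R(Q)X=\tfrac12(\mathrm{Ad}_Q+\mathrm{id})\circ\big((\mathrm{Ad}_Q-\mathrm{id})|_{\mathcal G_\perp}\big)^{-1}(X_\perp),\qquad X\in\mathcal G .$$ Let $e_a$ be a basis of $\mathcal G$ with $\langle e_a,e_b\rangle=-\delta_{ab}$, and let $e_a^{i,L}$, $e_a^{i,R}$ be the vector fields on $G\times G$, tangent to the $i$-th factor, given by the left- and right-invariant vector fields on $G$ with value $e_a$ at the identity. The quasi-Poisson bracket of the internally fused double $G\times G$ is $\{\mathcal F,\mathcal H\}=(d\mathcal F\otimes d\mathcal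 H)(\Pi)$ with $$2\Pi=\sum_a\big(e_a^{1,L}\wedge e_a^{2,R}+e_a^{1,R}\wedge e_a^{2,L}+e_a^{1,R}\wedge e_a^{1,L}+e_a^{2,L}\wedge e_a^{2,R}-e_a^{1,R}\wedge e_a^{2,R}-e_a^{2,L}\wedge e_a^{1,L}\big),$$ where $v\wedge w=v\otimes w-w\otimes v$. The derivatives $\nabla_i F,\nabla_i'F\in\mathcal G$ with respect to a variable $g_i\in G$ are defined by $\langle X,\nabla_iF\rangle=\frac{d}{dt}\big|_{t=0}F(\ldots,e^{tX}g_i,\ldots)$ and $\langle X,\nabla_i'F\rangle=\frac{d}{dt}\big|_{t=0}F(\ldots,g_ie^{tX},\ldots)$ for all $X\in\mathcal G$. If the $i$-th variable is restricted to $G_0^{\rm reg}$, then $\nabla_iF\in\mathcal G_0$ is defined by the first equation for all $X\in\mathcal G_0$. Invariance of functions refers to the action of $G$ on $G\times G$ by simultaneous conjugation. (i) Let $F,H$ be the restrictions to $G_0^{\rm reg}\times G$ of smooth $G$-invariant real functions $\mathcal F,\mathcal H$ on $G^{\rm reg}\times G$. Then $\{F,H\}_{\rm red}(Q,g):=\{\mathcal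 F,\mathcal H\}(Q,g)$ is well defined, i.e. it depends only on $F$ and $H$, and at every $(Q,g)\in G_0^{\rm reg}\times G$ $$\{F,H\}_{\rm red}(Q,g)=\langle\nabla_1H,\nabla_2F\rangle-\langle\nabla_1F,\nabla_2H\rangle+\langle\nabla_2'F,\mathcal R(Q)\nabla_2'H\rangle-\langle\nabla_2F,\mathcal R(Q)\nabla_2H\rangle .$$ (ii) Let $F,H$ be the restrictions to $G\times G_0^{\rm reg}$ of smooth $G$-invariant real functions $\mathcal F,\mathcal H$ on $G\times G^{\rm reg}$. Then $\{F,H\}'_{\rm red}(g,Q):=\{\mathcal F,\mathcal H\}(g,Q)$ is well defined in the same sense, and at every $(g,Q)\in G\times G_0^{\rm reg}$ $$\{F,H\}'_{\rm red}(g,Q)=\langle\nabla_2F,\nabla_1H\rangle-\langle\nabla_2H,\nabla_1F\rangle+\langle\nabla_1F,\mathcal R(Q)\nabla_1H\rangle-\langle\nabla_1'F,\mathcal R(Q)\nabla_1'H\rangle .$$ -/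

import Mathlib

open scoped Manifold ContDiff TensorProduct

namespace QPDouble

noncomputable section

/-- Over `ℝ` one has `minSmoothness ℝ 3 = 3`, so a smooth Lie group has the regularity that is
needed for the Lie bracket on `GroupLieAlgebra`. -/
instance instLEInftyMinSmoothness : ENat.LEInfty (minSmoothness ℝ 3) :=
  ⟨by
    rw [minSmoothness_of_isRCLikeNormedField]
    exact (inferInstance : ENat.LEInfty (3 : WithTop ℕ∞)).out⟩

variable {E : Type*} [NormedAddCommGroup E] [NormedSpace ℝ E]
  {G : Type*} [TopologicalSpace G] [ChartedSpace E G] [Group G]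

/-! ### Lie group preliminaries -/

/-- The exponential map: `exp X = γ 1`, where `γ` is the (unique, globally defined) integral curve
through the identity of the left-invariant vector field with value `X` at the identity. -/
def lieExp (X : GroupLieAlgebra 𝓘(ℝ, E) G) : G :=
  Classical.epsilon
    (fun γ : ℝ → G => γ 0 = 1 ∧ IsMIntegralCurve γ (mulInvariantVectorField X)) 1

/-- The adjoint action of `g` on the Lie algebra: the derivative at the identity of
`h ↦ g * h * g⁻¹`. -/
def Ad (g : G) : GroupLieAlgebra 𝓘(ℝ, E) G → GroupLieAlgebra 𝓘(ℝ, E) G :=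
  fun X => mfderiv 𝓘(ℝ, E) 𝓘(ℝ, E) (fun h : G => g * h * g⁻¹) 1 X

/-- The right-invariant vector field with value `X` at the identity. -/
def rightInvariantVectorField (X : GroupLieAlgebra 𝓘(ℝ, E) G) (g : G) :
    TangentSpace 𝓘(ℝ, E) g :=
  mfderiv 𝓘(ℝ, E) 𝓘(ℝ, E) (fun h : G => h * g) 1 X

/-- A torus in a Lie group: a compact connected commutative subgroup (compact subgroups are closed,
hence they are Lie subgroups). -/
def IsTorus (T : Subgroup G) : Prop :=
  IsCompact (T : Set G) ∧ IsConnected (T : Set G) ∧ ∀ x ∈ T, ∀ y ∈ T, x * y = y * x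

/-- A maximal torus. -/
def IsMaximalTorus (T : Subgroup G) : Prop :=
  IsTorus T ∧ ∀ S : Subgroup G, IsTorus S → T ≤ S → S = T

/-- `g` is regular if its isotropy group with respect to conjugations is a maximal torus. -/
def IsRegular (g : G) : Prop :=
  IsMaximalTorus (Subgroup.centralizer ({g} : Set G))

/-- The set of regular elements of the subgroup `G₀`. -/
def regularPart (G₀ : Subgroup G) : Set G := {Q | Q ∈ G₀ ∧ IsRegular Q}

/-- The Lie algebra of a closed subgroup: all `X` with `exp (t X) ∈ G₀` for all real `t`. -/
def subLieAlgebra (G₀ : Subgroup G) : Set (GroupLieAlgebra 𝓘(ℝ, E) G) :=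
  {X | ∀ t : ℝ, lieExp (t • X) ∈ G₀}

/-! ### The `r`-matrix -/

section RMatrix

variable (β : LinearMap.BilinForm ℝ (GroupLieAlgebra 𝓘(ℝ, E) G))

/-- The orthogonal complement `𝔤_⊥` of the Lie algebra `𝔤₀` of `G₀`. -/
def perp (G₀ : Subgroup G) : Set (GroupLieAlgebra 𝓘(ℝ, E) G) :=
  {Y | ∀ X ∈ subLieAlgebra (E := E) G₀, β X Y = 0}

/-- The component `X_⊥` of `X = X₀ + X_⊥` with `X₀ ∈ 𝔤₀` and `X_⊥ ∈ 𝔤_⊥`. -/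
def perpPart (G₀ : Subgroup G) (X : GroupLieAlgebra 𝓘(ℝ, E) G) : GroupLieAlgebra 𝓘(ℝ, E) G :=
  Classical.epsilon fun Y => Y ∈ perp β G₀ ∧ X - Y ∈ subLieAlgebra (E := E) G₀

/-- The trigonometric `r`-matrix
`ℛ(Q) X = ½ (Ad_Q + id) ∘ ((Ad_Q - id) restricted to 𝔤_⊥)⁻¹ (X_⊥)`. -/
def rMatrix (G₀ : Subgroup G) (Q : G) (X : GroupLieAlgebra 𝓘(ℝ, E) G) :
    GroupLieAlgebra 𝓘(ℝ, E) G :=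
  let Y := Function.invFunOn (fun Z => Ad Q Z - Z) (perp β G₀) (perpPart β G₀ X)
  (1 / 2 : ℝ) • (Ad Q Y + Y)

end RMatrix

/-! ### Lie algebra valued derivatives of functions on `G × G` -/

section Gradients

variable (β : LinearMap.BilinForm ℝ (GroupLieAlgebra 𝓘(ℝ, E) G))
  (W : Set (GroupLieAlgebra 𝓘(ℝ, E) G)) (F : G × G → ℝ) (p : G × G)

/-- The vector `v ∈ W` that represents `φ` on `W`: `⟨X, v⟩ = φ X` for all `X ∈ W`. -/
def gradOn (φ : GroupLieAlgebra 𝓘(ℝ, E) G → ℝ) : GroupLieAlgebra 𝓘(ℝ, E) G :=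
  Classical.epsilon fun v => v ∈ W ∧ ∀ X ∈ W, β X v = φ X

/-- The `W`-valued derivative `∇₁`: `⟨X, ∇₁F⟩ = d/dt F(exp(tX) g₁, g₂)` at `t = 0`, `X ∈ W`.
It is used with `W` the whole Lie algebra and with `W = 𝔤₀`. -/
def nabla1 : GroupLieAlgebra 𝓘(ℝ, E) G :=
  gradOn β W fun X => deriv (fun t : ℝ => F (lieExp (t • X) * p.1, p.2)) 0

/-- `⟨X, ∇₁'F⟩ = d/dt F(g₁ exp(tX), g₂)` at `t = 0`. -/
def nabla1' : GroupLieAlgebra 𝓘(ℝ, E) G :=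
  gradOn β Set.univ fun X => deriv (fun t : ℝ => F (p.1 * lieExp (t • X), p.2)) 0

/-- The `W`-valued derivative `∇₂`: `⟨X, ∇₂F⟩ = d/dt F(g₁, exp(tX) g₂)` at `t = 0`, `X ∈ W`. -/
def nabla2 : GroupLieAlgebra 𝓘(ℝ, E) G :=
  gradOn β W fun X => deriv (fun t : ℝ => F (p.1, lieExp (t • X) * p.2)) 0

/-- `⟨X, ∇₂'F⟩ = d/dt F(g₁, g₂ exp(tX))` at `t = 0`. -/
def nabla2' : GroupLieAlgebra 𝓘(ℝ, E) G :=
  gradOn β Set.univ fun X => deriv (fun t : ℝ => F (p.1, p.2 * lieExp (t • X))) 0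

end Gradients

/-! ### The quasi-Poisson bivector of the internally fused double -/

section Bivector

/-- A tangent vector of the first factor, as a tangent vector of `G × G`. -/
def inFst (p : G × G) (v : TangentSpace 𝓘(ℝ, E) p.1) :
    TangentSpace (𝓘(ℝ, E).prod 𝓘(ℝ, E)) p :=
  Prod.mk (α := TangentSpace 𝓘(ℝ, E) p.1) (β := TangentSpace 𝓘(ℝ, E) p.2) v 0

/-- A tangent vector of the second factor, as a tangent vector of `G × G`. -/
def inSnd (p : G × G) (v : TangentSpace 𝓘(ℝ, E) p.2) :
    TangentSpace (𝓘(ℝ, E).prod 𝓘(ℝ, E)) p :=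
  Prod.mk (α := TangentSpace 𝓘(ℝ, E) p.1) (β := TangentSpace 𝓘(ℝ, E) p.2) 0 v

/-- The vector field `X^{1,L}` on `G × G`. -/
def L1 (X : GroupLieAlgebra 𝓘(ℝ, E) G) (p : G × G) : TangentSpace (𝓘(ℝ, E).prod 𝓘(ℝ, E)) p :=
  inFst p (mulInvariantVectorField X p.1)

/-- The vector field `X^{1,R}` on `G × G`. -/
def R1 (X : GroupLieAlgebra 𝓘(ℝ, E) G) (p : G × G) : TangentSpace (𝓘(ℝ, E).prod 𝓘(ℝ, E)) p :=
  inFst p (rightInvariantVectorField X p.1)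

/-- The vector field `X^{2,L}` on `G × G`. -/
def L2 (X : GroupLieAlgebra 𝓘(ℝ, E) G) (p : G × G) : TangentSpace (𝓘(ℝ, E).prod 𝓘(ℝ, E)) p :=
  inSnd p (mulInvariantVectorField X p.2)

/-- The vector field `X^{2,R}` on `G × G`. -/
def R2 (X : GroupLieAlgebra 𝓘(ℝ, E) G) (p : G × G) : TangentSpace (𝓘(ℝ, E).prod 𝓘(ℝ, E)) p :=
  inSnd p (rightInvariantVectorField X p.2)

/-- The wedge product `v ∧ w = v ⊗ w - w ⊗ v` (without the factor `½`). -/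
def wedge {V : Type*} [AddCommGroup V] [Module ℝ V] (v w : V) : V ⊗[ℝ] V :=
  v ⊗ₜ[ℝ] w - w ⊗ₜ[ℝ] v

variable {ι : Type*} [Fintype ι] (e : Module.Basis ι ℝ (GroupLieAlgebra 𝓘(ℝ, E) G))

/-- The bivector `Π` of the internally fused double, with respect to the basis `e`. -/
def bivector (p : G × G) :
    TangentSpace (𝓘(ℝ, E).prod 𝓘(ℝ, E)) p ⊗[ℝ] TangentSpace (𝓘(ℝ, E).prod 𝓘(ℝ, E)) p :=
  (1 / 2 : ℝ) • ∑ a,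
    (wedge (L1 (e a) p) (R2 (e a) p) + wedge (R1 (e a) p) (L2 (e a) p)
      + wedge (R1 (e a) p) (L1 (e a) p) + wedge (L2 (e a) p) (R2 (e a) p)
      - wedge (R1 (e a) p) (R2 (e a) p) - wedge (L2 (e a) p) (L1 (e a) p))

/-- The differential of a real function on `G × G` at a point. -/
def differential (F : G × G → ℝ) (p : G × G) :
    TangentSpace (𝓘(ℝ, E).prod 𝓘(ℝ, E)) p →ₗ[ℝ] ℝ :=
  (mfderiv (𝓘(ℝ, E).prod 𝓘(ℝ, E)) 𝓘(ℝ, ℝ) F p).toLinearMap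

/-- The quasi-Poisson bracket `{F, H} = (dF ⊗ dH)(Π)`. -/
def qpBracket (F H : G × G → ℝ) (p : G × G) : ℝ :=
  LinearMap.mul' ℝ ℝ
    (TensorProduct.map (differential (E := E) F p) (differential (E := E) H p) (bivector e p))

/-! ### Invariant functions, slices, reduced brackets -/

variable (E) in
/-- `F` is smooth on the open conjugation-invariant set `D ⊆ G × G` and invariant there under
simultaneous conjugation; the values of `F` outside `D` are irrelevant. -/
def IsSmoothInvariantOn (D : Set (G × G)) (F : G × G → ℝ) : Prop :=
  (∀ p ∈ D, ContMDiffAt (𝓘(ℝ, E).prod 𝓘(ℝ, E)) 𝓘(ℝ, ℝ) ∞ F p) ∧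
    ∀ η : G, ∀ p ∈ D, F (η * p.1 * η⁻¹, η * p.2 * η⁻¹) = F p

variable (G) in
/-- `G^reg × G`. -/
def regFst : Set (G × G) := {p | IsRegular p.1}

variable (G) in
/-- `G × G^reg`. -/
def regSnd : Set (G × G) := {p | IsRegular p.2}

/-- The slice `G₀^reg × G`. -/
def sliceFst (G₀ : Subgroup G) : Set (G × G) := {p | p.1 ∈ regularPart G₀}

/-- The slice `G × G₀^reg`. -/
def sliceSnd (G₀ : Subgroup G) : Set (G × G) := {p | p.2 ∈ regularPart G₀}

/-- The reduced bracket of functions `F`, `H` on the slice `S` of `D`: the quasi-Poisson bracket of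
smooth invariant functions on `D` whose restrictions to `S` are `F` and `H`. -/
def reducedBracket (D S : Set (G × G)) (F H : G × G → ℝ) (p : G × G) : ℝ :=
  let K := Classical.epsilon fun K : (G × G → ℝ) × (G × G → ℝ) =>
    IsSmoothInvariantOn E D K.1 ∧ IsSmoothInvariantOn E D K.2 ∧
      Set.EqOn F K.1 S ∧ Set.EqOn H K.2 S
  qpBracket e K.1 K.2 p

end Bivector

end

end QPDouble

namespace QPDouble

open scoped Topology
open Set Filter

noncomputable section

/-! ### Velocities of curves -/

section Velocity

variable {E : Type*} [NormedAddCommGroup E] [NormedSpace ℝ E]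
  {H : Type*} [TopologicalSpace H] {I : ModelWithCorners ℝ E H}
  {M : Type*} [TopologicalSpace M] [ChartedSpace H M]
  {E' : Type*} [NormedAddCommGroup E'] [NormedSpace ℝ E']
  {H' : Type*} [TopologicalSpace H'] {I' : ModelWithCorners ℝ E' H'}
  {M' : Type*} [TopologicalSpace M'] [ChartedSpace H' M']

/-! Write a, a', b, b' for the four derivatives ∇₁, ∇₁', ∇₂, ∇₂' of an invariant extension at a
point (Q, g) of the first slice. Three facts relate them. Left and right derivatives are intertwined
by the adjoint action (`IsGradient.ad_fst`), invariance gives a - a' + b - b' = 0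
(`IsGradient.invariance`), and contracting the bivector with an orthonormal basis makes the bracket
a fixed bilinear expression in the derivatives of the two functions (`qpBracket_eq`).

Since Q is regular, the fixed space of `Ad Q` is the torus Lie algebra W (`Ad_eq_self_iff`), and `Ad
Q - id` is invertible on the orthogonal complement of W (`exists_fixed_add_sub`). So b = b₀ + (Ad_Q
z - z) and b' = b₀' + (Ad_Q z' - z') with z, z' in that complement. The relations above force b₀ =
b₀' and a' = a₀ + (z' - z), where a₀ is the projection of a to W. Thus b, b' and a₀, which are
visible on the slice, determine all four derivatives. Expanding, with ℛ(Q) sending b to ½(Ad_Q z +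
z), gives the formula (`reduced_bracket_identity`). Its right side involves only the restricted
functions, so independence of the extensions follows from the formula itself.

The linear algebra needs a definite, Ad-invariant form. Definiteness comes from the orthonormal
basis, and invariance from the Killing form (`killingForm_Ad`), because `Ad g` is a Lie algebra
automorphism.

The analytic point is that a₀ is the gradient of the restricted function: the curve exp(tX)Q must
stay regular for small t, that is, the regular elements must be open in the torus
(`eventually_mem_regularPart`). By compactness of the group this reduces to elements h near 1
commuting with some q in the torus near Q. In the coset of h, minimise a quadratic distance to 1 in
a chart: the minimiser is nearly orthogonal to W and nearly fixed by `Ad Q`, hence equal to 1, so h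
lies in the torus. -/

variable (I) in
/-- The curve `c` is at `x` at time `t`, with velocity `v`. -/
def HasVelocityAt (c : ℝ → M) (t : ℝ) (x : M) (v : TangentSpace I x) : Prop :=
  c t = x ∧ ∃ L : ℝ →L[ℝ] E, HasMFDerivAt 𝓘(ℝ, ℝ) I c t L ∧ L 1 = v

lemma hasVelocityAt_iff {c : ℝ → M} {t : ℝ} {v : TangentSpace I (c t)} :
    HasVelocityAt I c t (c t) v ↔
      HasMFDerivAt 𝓘(ℝ, ℝ) I c t ((1 : ℝ →L[ℝ] ℝ).smulRight v) := by
  constructor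
  · rintro ⟨-, L, hL, hv⟩
    have : (1 : ℝ →L[ℝ] ℝ).smulRight (v : E) = L := by
      ext
      rw [ContinuousLinearMap.smulRight_apply]
      exact (one_smul ℝ (v : E)).trans hv.symm
    subst this
    exact hL
  · intro h
    exact ⟨rfl, _, h, (one_smul ℝ (v : E) : (1 : ℝ) • (v : E) = v)⟩

lemma HasVelocityAt.congr_velocity {c : ℝ → M} {t : ℝ} {x : M} {v w : TangentSpace I x}
    (h : HasVelocityAt I c t x v) (hvw : v = w) : HasVelocityAt I c t x w := hvw ▸ h

lemma HasVelocityAt.comp {c : ℝ → M} {t : ℝ} {x : M} {v : TangentSpace I x}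
    (h : HasVelocityAt I c t x v) {f : M → M'} (hf : MDifferentiableAt I I' f x) :
    HasVelocityAt I' (fun s => f (c s)) t (f x) (mfderiv I I' f x v) := by
  obtain ⟨rfl, L, h, rfl⟩ := h
  exact ⟨rfl, _, hf.hasMFDerivAt.comp t h, rfl⟩

lemma HasVelocityAt.prodMk {c : ℝ → M} {t : ℝ} {x : M} {v : TangentSpace I x}
    {c' : ℝ → M'} {x' : M'} {v' : TangentSpace I' x'}
    (h : HasVelocityAt I c t x v) (h' : HasVelocityAt I' c' t x' v') :
    HasVelocityAt (I.prod I') (fun s => (c s, c' s)) t (x, x')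
      (Prod.mk (α := TangentSpace I x) (β := TangentSpace I' x') v v') := by
  obtain ⟨rfl, L, h, rfl⟩ := h
  obtain ⟨rfl, L', h', rfl⟩ := h'
  exact ⟨rfl, _, h.prodMk h', rfl⟩

lemma hasVelocityAt_const (x : M) (t : ℝ) : HasVelocityAt I (fun _ => x) t x 0 :=
  ⟨rfl, _, hasMFDerivAt_const x t, rfl⟩

lemma HasVelocityAt.comp_add_const {c : ℝ → M} {t s : ℝ} {x : M} {v : TangentSpace I x}
    (h : HasVelocityAt I c (t + s) x v) : HasVelocityAt I (fun r => c (r + s)) t x v := by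
  obtain ⟨rfl, L, h, rfl⟩ := h
  have h2 : HasMFDerivAt 𝓘(ℝ, ℝ) 𝓘(ℝ, ℝ) (fun r : ℝ => r + s) t (ContinuousLinearMap.id ℝ ℝ) :=
    ((hasFDerivAt_id t).add_const s).hasMFDerivAt
  exact ⟨rfl, _, HasMFDerivAt.comp t h h2, rfl⟩

lemma HasVelocityAt.comp_mul_const {c : ℝ → M} {t a : ℝ} {x : M} {v : TangentSpace I x}
    (h : HasVelocityAt I c (t * a) x v) : HasVelocityAt I (fun r => c (r * a)) t x (a • v) := by
  obtain ⟨rfl, L, h, rfl⟩ := h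
  have h2 : HasMFDerivAt 𝓘(ℝ, ℝ) 𝓘(ℝ, ℝ) (fun r : ℝ => r * a) t
      (a • ContinuousLinearMap.id ℝ ℝ) :=
    ((hasFDerivAt_id t).mul_const a).hasMFDerivAt
  refine ⟨rfl, _, HasMFDerivAt.comp t h h2, ?_⟩
  change L (a • (1 : ℝ)) = a • (L 1 : E)
  exact L.map_smul a 1

lemma HasVelocityAt.unique {c : ℝ → M} {t : ℝ} {x : M} {v w : TangentSpace I x}
    (h : HasVelocityAt I c t x v) (h' : HasVelocityAt I c t x w) : v = w := by
  obtain ⟨rfl, L, h, rfl⟩ := h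
  obtain ⟨-, L', h', rfl⟩ := h'
  exact DFunLike.congr_fun (hasMFDerivAt_unique h h') (1 : ℝ)

lemma HasVelocityAt.tendsto {c : ℝ → M} {t : ℝ} {x : M} {v : TangentSpace I x}
    (h : HasVelocityAt I c t x v) : Tendsto c (𝓝 t) (𝓝 x) := by
  obtain ⟨rfl, L, h, -⟩ := h
  exact h.1

lemma HasVelocityAt.hasDerivAt {V : Type*} [NormedAddCommGroup V] [NormedSpace ℝ V]
    {c : ℝ → V} {t : ℝ} {x : V} {v : V}
    (h : HasVelocityAt 𝓘(ℝ, V) c t x v) : HasDerivAt c v t := by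
  obtain ⟨-, L, h, rfl⟩ := h
  have h' : HasFDerivAt (𝕜 := ℝ) (F := V) c L t := hasMFDerivAt_iff_hasFDerivAt.1 h
  exact h'.hasDerivAt

/-- The derivative of a function along a curve. -/
lemma HasVelocityAt.hasDerivAt_comp {c : ℝ → M} {t : ℝ} {x : M} {v : TangentSpace I x}
    (h : HasVelocityAt I c t x v) {V : Type*} [NormedAddCommGroup V] [NormedSpace ℝ V]
    {f : M → V} (hf : MDifferentiableAt I 𝓘(ℝ, V) f x) :
    HasDerivAt (fun s => f (c s)) (mfderiv I 𝓘(ℝ, V) f x v) t :=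
  (h.comp hf).hasDerivAt

end Velocity

/-! ### The exponential map and one-parameter subgroups. -/

section LieGroup

set_option linter.unusedSectionVars false

variable {E : Type*} [NormedAddCommGroup E] [NormedSpace ℝ E]
  {G : Type*} [TopologicalSpace G] [ChartedSpace E G] [Group G] [LieGroup 𝓘(ℝ, E) ∞ G]

lemma mfderiv_apply_congr {f f' : G → G} (h : f = f') (x : G) (v : E) :
    (mfderiv 𝓘(ℝ, E) 𝓘(ℝ, E) f x v : E) = (mfderiv 𝓘(ℝ, E) 𝓘(ℝ, E) f' x v : E) := by
  subst h
  rfl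

lemma mdifferentiableAt_mul_left (g h : G) :
    MDifferentiableAt 𝓘(ℝ, E) 𝓘(ℝ, E) (fun x : G => g * x) h :=
  (contMDiff_mul_left (I := 𝓘(ℝ, E)) (n := ∞)).mdifferentiable (by simp) h

lemma mdifferentiableAt_mul_right (g h : G) :
    MDifferentiableAt 𝓘(ℝ, E) 𝓘(ℝ, E) (fun x : G => x * g) h :=
  (contMDiff_mul_right (I := 𝓘(ℝ, E)) (n := ∞)).mdifferentiable (by simp) h

lemma contMDiff_conj (g : G) :
    ContMDiff 𝓘(ℝ, E) 𝓘(ℝ, E) ∞ (fun x : G => g * x * g⁻¹) :=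
  (contMDiff_mul_right (I := 𝓘(ℝ, E)) (n := ∞)).comp contMDiff_mul_left

lemma mdifferentiableAt_conj (g h : G) :
    MDifferentiableAt 𝓘(ℝ, E) 𝓘(ℝ, E) (fun x : G => g * x * g⁻¹) h :=
  (contMDiff_conj g).mdifferentiable (by simp) h

lemma HasVelocityAt.const_mul {c : ℝ → G} {t : ℝ} {X : GroupLieAlgebra 𝓘(ℝ, E) G}
    (h : HasVelocityAt 𝓘(ℝ, E) c t 1 X) (g : G) :
    HasVelocityAt 𝓘(ℝ, E) (fun s => g * c s) t g (mulInvariantVectorField X g) := by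
  have := h.comp (mdifferentiableAt_mul_left g 1)
  exact ⟨by simpa using this.1, this.2⟩

lemma HasVelocityAt.mul_const {c : ℝ → G} {t : ℝ} {X : GroupLieAlgebra 𝓘(ℝ, E) G}
    (h : HasVelocityAt 𝓘(ℝ, E) c t 1 X) (g : G) :
    HasVelocityAt 𝓘(ℝ, E) (fun s => c s * g) t g (rightInvariantVectorField X g) := by
  have := h.comp (mdifferentiableAt_mul_right g 1)
  exact ⟨by simpa using this.1, this.2⟩

lemma HasVelocityAt.conj {c : ℝ → G} {t : ℝ} {X : GroupLieAlgebra 𝓘(ℝ, E) G}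
    (h : HasVelocityAt 𝓘(ℝ, E) c t 1 X) (g : G) :
    HasVelocityAt 𝓘(ℝ, E) (fun s => g * c s * g⁻¹) t 1 (Ad g X) := by
  have := h.comp (mdifferentiableAt_conj g 1)
  exact ⟨by simpa using this.1, this.2⟩

lemma mulInvariantVectorField_one (X : GroupLieAlgebra 𝓘(ℝ, E) G) :
    mulInvariantVectorField X (1 : G) = X := by
  have : (fun x : G => 1 * x) = id := by ext; simp
  rw [mulInvariantVectorField, this, mfderiv_id]
  rfl

lemma rightInvariantVectorField_one (X : GroupLieAlgebra 𝓘(ℝ, E) G) :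
    rightInvariantVectorField X (1 : G) = X := by
  have : (fun x : G => x * 1) = id := by ext; simp
  rw [rightInvariantVectorField, this, mfderiv_id]
  rfl

/-- The velocity of `a t * g * b t`, where `a` and `b` pass through the identity. -/
lemma HasVelocityAt.mul_mul {a b : ℝ → G} {t : ℝ} {X Y : GroupLieAlgebra 𝓘(ℝ, E) G}
    (ha : HasVelocityAt 𝓘(ℝ, E) a t 1 X) (hb : HasVelocityAt 𝓘(ℝ, E) b t 1 Y) (g : G) :
    HasVelocityAt 𝓘(ℝ, E) (fun s => a s * g * b s) t g
      (rightInvariantVectorField X g + mulInvariantVectorField Y g) := by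
  have hf : MDifferentiableAt (𝓘(ℝ, E).prod 𝓘(ℝ, E)) 𝓘(ℝ, E)
      (fun p : G × G => p.1 * g * p.2) (1, 1) := by
    have : ContMDiff (𝓘(ℝ, E).prod 𝓘(ℝ, E)) 𝓘(ℝ, E) ∞ (fun p : G × G => p.1 * g * p.2) :=
      ((contMDiff_mul_right (I := 𝓘(ℝ, E)) (n := ∞)).comp contMDiff_fst).mul contMDiff_snd
    exact this.mdifferentiable (by simp) _
  have h := (ha.prodMk hb).comp hf
  refine ⟨by simp [ha.1, hb.1], ?_⟩
  have e : mfderiv (𝓘(ℝ, E).prod 𝓘(ℝ, E)) 𝓘(ℝ, E) (fun p : G × G => p.1 * g * p.2) (1, 1)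
      (Prod.mk (α := GroupLieAlgebra 𝓘(ℝ, E) G) (β := GroupLieAlgebra 𝓘(ℝ, E) G) X Y) =
      (rightInvariantVectorField X g + mulInvariantVectorField Y g : E) := by
    refine (mfderiv_prod_eq_add_apply hf).trans ?_
    have h1 : (fun z : G => z * g * 1) = fun z => z * g := by ext; simp
    have h2 : (fun z : G => 1 * g * z) = fun z => g * z := by ext; simp
    exact congrArg₂ (fun v w : E => v + w) (mfderiv_apply_congr (E := E) h1 1 X)
      (mfderiv_apply_congr (E := E) h2 1 Y)
  rw [← e]
  exact h.2

variable [CompleteSpace E] [T2Space G]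

lemma contMDiff_one_mulInvariantVectorField (X : GroupLieAlgebra 𝓘(ℝ, E) G) :
    ContMDiff 𝓘(ℝ, E) 𝓘(ℝ, E).tangent 1
      (fun g : G => (⟨g, mulInvariantVectorField X g⟩ : TangentBundle 𝓘(ℝ, E) G)) := by
  have : LieGroup 𝓘(ℝ, E) (minSmoothness ℝ 3) G := inferInstance
  refine (contMDiff_mulInvariantVectorField X).of_le ?_
  exact le_trans (by norm_num) le_minSmoothness

lemma isManifold_one : IsManifold 𝓘(ℝ, E) 1 G := 
  IsManifold.of_le (n := ∞) (by norm_cast)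

lemma HasVelocityAt.left_translate {c : ℝ → G} {t : ℝ} {h : G}
    {X : GroupLieAlgebra 𝓘(ℝ, E) G}
    (hc : HasVelocityAt 𝓘(ℝ, E) c t h (mulInvariantVectorField X h)) (g : G) :
    HasVelocityAt 𝓘(ℝ, E) (fun s => g * c s) t (g * h) (mulInvariantVectorField X (g * h)) := by
  refine (hc.comp (mdifferentiableAt_mul_left g h)).congr_velocity ?_
  have e : (fun x : G => (g * h) * x) = (fun x => g * x) ∘ (fun x => h * x) := by
    ext; simp [mul_assoc]
  rw [mulInvariantVectorField, mulInvariantVectorField, e]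
  exact (mfderiv_comp_apply_of_eq (I := 𝓘(ℝ, E)) (I' := 𝓘(ℝ, E)) (I'' := 𝓘(ℝ, E)) (1 : G)
    (mdifferentiableAt_mul_left g h) (mdifferentiableAt_mul_left h 1) (by simp) X).symm

lemma isMIntegralCurve_iff_hasVelocityAt {γ : ℝ → G} {X : GroupLieAlgebra 𝓘(ℝ, E) G} :
    IsMIntegralCurve γ (mulInvariantVectorField X) ↔
      ∀ t, HasVelocityAt 𝓘(ℝ, E) γ t (γ t) (mulInvariantVectorField X (γ t)) :=
  forall_congr' fun _ => hasVelocityAt_iff.symm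

lemma isMIntegralCurve_of_hom {c : ℝ → G} (hom : ∀ s t, c (s + t) = c s * c t)
    {X : GroupLieAlgebra 𝓘(ℝ, E) G} (h : HasVelocityAt 𝓘(ℝ, E) c 0 1 X) :
    IsMIntegralCurve c (mulInvariantVectorField X) := by
  rw [isMIntegralCurve_iff_hasVelocityAt]
  intro t
  have h1 := h.const_mul (c t)
  rw [← sub_self t, sub_eq_add_neg] at h1
  have h2 := h1.comp_add_const
  have h3 : (fun r => c t * c (r + -t)) = c := by
    ext r
    rw [← hom]
    congr 1
    ring
  rwa [h3] at h2

lemma integralCurve_unique {γ γ' : ℝ → G} {X : GroupLieAlgebra 𝓘(ℝ, E) G}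
    (h : IsMIntegralCurve γ (mulInvariantVectorField X))
    (h' : IsMIntegralCurve γ' (mulInvariantVectorField X)) (h0 : γ 0 = γ' 0) : γ = γ' := by
  have := isManifold_one (E := E) (G := G)
  exact isMIntegralCurve_Ioo_eq_of_contMDiff_boundaryless
    (contMDiff_one_mulInvariantVectorField X) h h' h0

/-- Left translation carries a local integral curve through 1 to one through any other point, with
the same lifetime ε. A uniform lifetime makes the field complete. -/
lemma exists_integralCurve (X : GroupLieAlgebra 𝓘(ℝ, E) G) :
    ∃ γ : ℝ → G, γ 0 = 1 ∧ IsMIntegralCurve γ (mulInvariantVectorField X) := by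
  have := isManifold_one (E := E) (G := G)
  have hX := contMDiff_one_mulInvariantVectorField X
  obtain ⟨γ, h0, hγ⟩ := exists_isMIntegralCurveAt_of_contMDiffAt_boundaryless (t₀ := 0)
    (hX.contMDiffAt (x := (1 : G)))
  obtain ⟨ε, hε, hγ⟩ := isMIntegralCurveAt_iff'.1 hγ
  refine exists_isMIntegralCurve_of_isMIntegralCurveOn hX hε (fun x => ?_) 1
  refine ⟨fun t => x * γ t, by simp [h0], fun t ht => ?_⟩
  have h1 := hγ t (by simpa [Real.ball_eq_Ioo] using ht)
  have h2 : HasMFDerivAt 𝓘(ℝ, ℝ) 𝓘(ℝ, E) γ t _ :=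
    h1.hasMFDerivAt (Metric.isOpen_ball.mem_nhds (by simpa [Real.ball_eq_Ioo] using ht))
  exact (hasVelocityAt_iff.1 ((hasVelocityAt_iff.2 h2).left_translate x)).hasMFDerivWithinAt

lemma integralCurve_hom {γ : ℝ → G} {X : GroupLieAlgebra 𝓘(ℝ, E) G} (h0 : γ 0 = 1)
    (h : IsMIntegralCurve γ (mulInvariantVectorField X)) (s t : ℝ) :
    γ (s + t) = γ s * γ t := by
  have h1 : IsMIntegralCurve (fun r => γ s * γ r) (mulInvariantVectorField X) := by
    rw [isMIntegralCurve_iff_hasVelocityAt] at h ⊢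
    exact fun r => (h r).left_translate _
  have h2 : IsMIntegralCurve (fun r => γ (r + s)) (mulInvariantVectorField X) := by
    rw [isMIntegralCurve_iff_hasVelocityAt] at h ⊢
    exact fun r => (h (r + s)).comp_add_const
  have : γ s * γ t = γ (t + s) := congrFun (integralCurve_unique h1 h2 (by simp [h0])) t
  rw [this, add_comm]

lemma lieExp_eq {γ : ℝ → G} {X : GroupLieAlgebra 𝓘(ℝ, E) G} (h0 : γ 0 = 1)
    (h : IsMIntegralCurve γ (mulInvariantVectorField X)) : lieExp X = γ 1 := by
  have hs := Classical.epsilon_spec (p := fun γ : ℝ → G =>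
    γ 0 = 1 ∧ IsMIntegralCurve γ (mulInvariantVectorField X)) ⟨γ, h0, h⟩
  exact congrFun (integralCurve_unique hs.2 h (hs.1.trans h0.symm)) 1

/-- A one-parameter subgroup is the exponential of its velocity. -/
lemma lieExp_smul_eq_of_hom {c : ℝ → G} (hom : ∀ s t, c (s + t) = c s * c t)
    {X : GroupLieAlgebra 𝓘(ℝ, E) G} (h : HasVelocityAt 𝓘(ℝ, E) c 0 1 X) (t : ℝ) :
    lieExp (t • X) = c t := by
  have h1 : HasVelocityAt 𝓘(ℝ, E) (fun r => c (r * t)) 0 1 (t • X) :=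
    HasVelocityAt.comp_mul_const (by rwa [zero_mul])
  have h2 := lieExp_eq (by simpa using h.1)
    (isMIntegralCurve_of_hom (fun r s => by rw [add_mul, hom]) h1)
  simpa using h2

lemma exists_oneParam (X : GroupLieAlgebra 𝓘(ℝ, E) G) :
    ∃ c : ℝ → G, (∀ s t, c (s + t) = c s * c t) ∧ HasVelocityAt 𝓘(ℝ, E) c 0 1 X ∧
      ∀ t : ℝ, lieExp (t • X) = c t := by
  obtain ⟨γ, h0, hγ⟩ := exists_integralCurve X
  have hom := integralCurve_hom h0 hγ
  have hv : HasVelocityAt 𝓘(ℝ, E) γ 0 1 X := by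
    have := isMIntegralCurve_iff_hasVelocityAt.1 hγ 0
    rw [h0] at this
    exact this.congr_velocity (mulInvariantVectorField_one X)
  exact ⟨γ, hom, hv, lieExp_smul_eq_of_hom hom hv⟩

lemma hasVelocityAt_lieExp (X : GroupLieAlgebra 𝓘(ℝ, E) G) :
    HasVelocityAt 𝓘(ℝ, E) (fun t : ℝ => (lieExp (t • X) : G)) 0 1 X := by
  obtain ⟨c, -, hv, hc⟩ := exists_oneParam X
  simpa only [hc] using hv

lemma lieExp_add_smul (X : GroupLieAlgebra 𝓘(ℝ, E) G) (s t : ℝ) :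
    (lieExp ((s + t) • X) : G) = lieExp (s • X) * lieExp (t • X) := by
  obtain ⟨c, hom, -, hc⟩ := exists_oneParam X
  simp only [hc, hom]

lemma lieExp_zero_smul (X : GroupLieAlgebra 𝓘(ℝ, E) G) :
    (lieExp ((0 : ℝ) • X) : G) = 1 := (hasVelocityAt_lieExp X).1

lemma lieExp_neg_smul (X : GroupLieAlgebra 𝓘(ℝ, E) G) (t : ℝ) :
    (lieExp ((-t) • X) : G) = (lieExp (t • X))⁻¹ := by
  rw [eq_inv_iff_mul_eq_one, ← lieExp_add_smul, neg_add_cancel, lieExp_zero_smul]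

lemma conj_lieExp_smul (g : G) (X : GroupLieAlgebra 𝓘(ℝ, E) G) (t : ℝ) :
    lieExp (t • Ad g X) = g * lieExp (t • X) * g⁻¹ :=
  lieExp_smul_eq_of_hom (fun s t => by rw [lieExp_add_smul]; group)
    ((hasVelocityAt_lieExp X).conj g) t

/-- The product of two commuting one-parameter subgroups is again one, and its velocity at 0 is the
sum. This is what makes the Lie algebra of a torus closed under addition. -/
lemma lieExp_smul_add_of_commute {X Y : GroupLieAlgebra 𝓘(ℝ, E) G}
    (h : ∀ s t : ℝ, Commute (lieExp (s • X) : G) (lieExp (t • Y))) (t : ℝ) :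
    (lieExp (t • (X + Y)) : G) = lieExp (t • X) * lieExp (t • Y) := by
  have hv := (hasVelocityAt_lieExp X).mul_mul (hasVelocityAt_lieExp Y) 1
  simp only [mul_one, mulInvariantVectorField_one, rightInvariantVectorField_one] at hv
  refine lieExp_smul_eq_of_hom (c := fun t : ℝ => lieExp (t • X) * lieExp (t • Y))
    (fun r s => ?_) hv t
  simp only [lieExp_add_smul]
  exact (h s r).mul_mul_mul_comm _ _

end LieGroup

/-! ### The adjoint action by Lie algebra automorphisms, and invariance of the Killing form. -/

section Adjoint

set_option linter.unusedSectionVars false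

variable {E : Type*} [NormedAddCommGroup E] [NormedSpace ℝ E]
  {G : Type*} [TopologicalSpace G] [ChartedSpace E G] [Group G] [LieGroup 𝓘(ℝ, E) ∞ G]
  [CompleteSpace E] [T2Space G]

lemma Ad_eq_of_hasVelocityAt {c : ℝ → G} {g : G} {X Y : GroupLieAlgebra 𝓘(ℝ, E) G}
    (h : HasVelocityAt 𝓘(ℝ, E) (fun t => g * c t * g⁻¹) 0 1 Y)
    (hc : HasVelocityAt 𝓘(ℝ, E) c 0 1 X) : Ad g X = Y :=
  (hc.conj g).unique h

lemma Ad_one (X : GroupLieAlgebra 𝓘(ℝ, E) G) : Ad (1 : G) X = X :=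
  Ad_eq_of_hasVelocityAt (by simpa using hasVelocityAt_lieExp X) (hasVelocityAt_lieExp X)

lemma Ad_mul (g h : G) (X : GroupLieAlgebra 𝓘(ℝ, E) G) : Ad (g * h) X = Ad g (Ad h X) := by
  refine Ad_eq_of_hasVelocityAt ?_ (hasVelocityAt_lieExp X)
  convert ((hasVelocityAt_lieExp X).conj h).conj g using 2
  group

lemma mulInvariantVectorField_eq_right (g : G) (X : GroupLieAlgebra 𝓘(ℝ, E) G) :
    mulInvariantVectorField X g = rightInvariantVectorField (Ad g X) g := by
  refine ((hasVelocityAt_lieExp X).const_mul g).unique ?_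
  convert ((hasVelocityAt_lieExp X).conj g).mul_const g using 2
  group

variable (E) in
/-- The adjoint action as a linear equivalence. -/
def AdEquiv (g : G) : GroupLieAlgebra 𝓘(ℝ, E) G ≃ₗ[ℝ] GroupLieAlgebra 𝓘(ℝ, E) G where
  toFun := Ad g
  invFun := Ad g⁻¹
  map_add' X Y := (mfderiv 𝓘(ℝ, E) 𝓘(ℝ, E) (fun h : G => g * h * g⁻¹) 1).map_add X Y
  map_smul' a X := (mfderiv 𝓘(ℝ, E) 𝓘(ℝ, E) (fun h : G => g * h * g⁻¹) 1).map_smul a X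
  left_inv X := by rw [← Ad_mul, inv_mul_cancel, Ad_one]
  right_inv X := by rw [← Ad_mul, mul_inv_cancel, Ad_one]

@[simp] lemma AdEquiv_apply (g : G) (X : GroupLieAlgebra 𝓘(ℝ, E) G) :
    AdEquiv E g X = Ad g X := rfl

/-- Conjugation by `g` maps the left-invariant field of `X` to the one of `Ad g X`. -/
lemma mfderiv_conj_mulInvariantVectorField (g h : G) (X : GroupLieAlgebra 𝓘(ℝ, E) G) :
    mfderiv 𝓘(ℝ, E) 𝓘(ℝ, E) (fun x : G => g * x * g⁻¹) h (mulInvariantVectorField X h) =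
      mulInvariantVectorField (Ad g X) (g * h * g⁻¹) := by
  refine (((hasVelocityAt_lieExp X).const_mul h).comp (mdifferentiableAt_conj g h)).unique ?_
  convert ((hasVelocityAt_lieExp X).conj g).const_mul (g * h * g⁻¹) using 2
  group

/-- `mpullback` is defined through `ContinuousLinearMap.inverse`, which is zero on non-invertible
maps, so a two-sided inverse has to be exhibited before it can be evaluated. -/
lemma inverse_apply_eq_of_comp {A B : E →L[ℝ] E} (hAB : ∀ v, A (B v) = v)
    (hBA : ∀ v, B (A v) = v) {v w : E} (h : A v = w) : A.inverse w = v := by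
  have : A.inverse = B := ContinuousLinearMap.inverse_eq (by ext; simp [hAB]) (by ext; simp [hBA])
  rw [this, ← h, hBA]

lemma mfderiv_conj_conj {g g' h k : G} (hg : g' * g = 1) (hk : g * h * g⁻¹ = k) (v : E) :
    (mfderiv 𝓘(ℝ, E) 𝓘(ℝ, E) (fun x : G => g' * x * g'⁻¹) k
      (mfderiv 𝓘(ℝ, E) 𝓘(ℝ, E) (fun x : G => g * x * g⁻¹) h v : E) : E) = v := by
  refine (mfderiv_comp_apply_of_eq (I := 𝓘(ℝ, E)) (I' := 𝓘(ℝ, E)) (I'' := 𝓘(ℝ, E)) h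
    (mdifferentiableAt_conj g' k) (mdifferentiableAt_conj g h) hk v).symm.trans ?_
  have e : ((fun x : G => g' * x * g'⁻¹) ∘ fun x : G => g * x * g⁻¹) = id := by
    obtain rfl := eq_inv_of_mul_eq_one_left hg
    ext x
    simp [mul_assoc]
  have e2 := mfderiv_apply_congr (E := E) e h v
  rw [mfderiv_id] at e2
  exact e2

lemma mpullback_conj_mulInvariantVectorField (g : G) (X : GroupLieAlgebra 𝓘(ℝ, E) G) :
    VectorField.mpullback 𝓘(ℝ, E) 𝓘(ℝ, E) (fun x : G => g * x * g⁻¹)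
      (mulInvariantVectorField (Ad g X)) = mulInvariantVectorField X := by
  ext h
  refine inverse_apply_eq_of_comp (E := E)
    (B := mfderiv 𝓘(ℝ, E) 𝓘(ℝ, E) (fun x : G => g⁻¹ * x * g⁻¹⁻¹) (g * h * g⁻¹)) ?_ ?_
    (mfderiv_conj_mulInvariantVectorField g h X)
  · exact fun v => mfderiv_conj_conj (mul_inv_cancel g) (by group) v
  · exact fun v => mfderiv_conj_conj (inv_mul_cancel g) rfl v

/-- Pullback along conjugation by `g` takes the left-invariant field of `Ad g X` to that of `X` and
commutes with the bracket of vector fields; evaluate at the identity. -/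
lemma Ad_lie (g : G) (X Y : GroupLieAlgebra 𝓘(ℝ, E) G) :
    Ad g ⁅X, Y⁆ = ⁅Ad g X, Ad g Y⁆ := by
  have hM : LieGroup 𝓘(ℝ, E) (minSmoothness ℝ 3) G := inferInstance
  have hM2 : IsManifold 𝓘(ℝ, E) (minSmoothness ℝ 3) G := inferInstance
  -- Written as `Ad g Z`, the bracket also generates a left-invariant field whose pullback is known.
  obtain ⟨Z, hZ⟩ := (AdEquiv E g).surjective ⁅Ad g X, Ad g Y⁆
  rw [AdEquiv_apply] at hZ
  rw [← hZ]
  congr 1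
  have h1 : VectorField.mlieBracket 𝓘(ℝ, E) (mulInvariantVectorField (Ad g X))
      (mulInvariantVectorField (Ad g Y)) = mulInvariantVectorField (G := G) (Ad g Z) := by
    rw [hZ, GroupLieAlgebra.bracket_def, mulInvariantVector_mlieBracket]
  have h2 := VectorField.mpullback_mlieBracket (n := minSmoothness ℝ 3) (I := 𝓘(ℝ, E))
    (I' := 𝓘(ℝ, E))
    (f := fun x : G => g * x * g⁻¹) (x₀ := (1 : G)) (V := mulInvariantVectorField (Ad g X))
    (W := mulInvariantVectorField (Ad g Y)) (mdifferentiableAt_mulInvariantVectorField _)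
    (mdifferentiableAt_mulInvariantVectorField _)
    ((contMDiff_mul_right (I := 𝓘(ℝ, E)) (n := minSmoothness ℝ 3)).comp contMDiff_mul_left
      |>.contMDiffAt)
    (minSmoothness_monotone (by norm_cast))
  rw [h1, mpullback_conj_mulInvariantVectorField, mpullback_conj_mulInvariantVectorField,
    mpullback_conj_mulInvariantVectorField, mulInvariantVectorField_one] at h2
  rw [h2, GroupLieAlgebra.bracket_def]

lemma killingForm_Ad (g : G) (X Y : GroupLieAlgebra 𝓘(ℝ, E) G) :
    killingForm ℝ (GroupLieAlgebra 𝓘(ℝ, E) G) (Ad g X) (Ad g Y) =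
      killingForm ℝ (GroupLieAlgebra 𝓘(ℝ, E) G) X Y :=
  LieAlgebra.killingForm_of_equiv_apply
    (e := { AdEquiv E g with map_lie' := fun {X Y} => Ad_lie g X Y }) X Y

end Adjoint

/-! ### Linear algebra of an isometry and its fixed space -/

section Isometry

variable {V : Type*} [AddCommGroup V] [Module ℝ V] {B : LinearMap.BilinForm ℝ V}

/-- A negative definite form has a unique representing vector in every subspace. -/
lemma gradient_unique (hneg : ∀ x, B x x = 0 → x = 0) {W : Submodule ℝ V} {v w : V}
    (hv : v ∈ W) (hw : w ∈ W) (h : ∀ x ∈ W, B x v = B x w) : v = w := by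
  refine sub_eq_zero.1 (hneg _ ?_)
  have := h _ (W.sub_mem hv hw)
  rw [map_sub (B (v - w)), this, sub_self]

variable {A : V →ₗ[ℝ] V} {W : Submodule ℝ V}

/-- An isometry preserves the complement of its fixed space, so pairing with `W` isolates the first
summand. Then `z - z'` is fixed, hence lies both in `W` and in its complement. -/
lemma fixed_add_sub_unique (hneg : ∀ x, B x x = 0 → x = 0)
    (hA : ∀ x y, B (A x) (A y) = B x y) (hW : ∀ x, A x = x ↔ x ∈ W) {x₀ y₀ z z' : V}
    (hx : x₀ ∈ W) (hy : y₀ ∈ W) (hz : ∀ y ∈ W, B y z = 0) (hz' : ∀ y ∈ W, B y z' = 0)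
    (h : x₀ + (A z - z) = y₀ + (A z' - z')) : x₀ = y₀ ∧ z = z' := by
  have hAz : ∀ v, (∀ y ∈ W, B y v = 0) → ∀ y ∈ W, B y (A v) = 0 := fun v hv y hy => by
    conv_lhs => rw [← (hW y).2 hy]
    rw [hA, hv y hy]
  have h0 : x₀ = y₀ := by
    refine gradient_unique hneg hx hy fun y hy => ?_
    have := congrArg (B y) h
    simpa [hz y hy, hz' y hy, hAz z hz y hy, hAz z' hz' y hy] using this
  subst h0
  refine ⟨rfl, ?_⟩
  have h1 : A (z - z') = z - z' := by
    rw [map_sub]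
    have := add_left_cancel h
    rw [sub_eq_sub_iff_add_eq_add] at this ⊢
    rw [this, add_comm]
  refine sub_eq_zero.1 (hneg _ ?_)
  have h2 := (hW _).1 h1
  rw [map_sub (B (z - z')), hz _ h2, hz' _ h2, sub_zero]

variable [FiniteDimensional ℝ V]

/-- Anisotropy makes the restriction of the form to `W` nondegenerate, so `W` and its orthogonal are
complementary. -/
lemma exists_orthogonal_decomposition (hneg : ∀ x, B x x = 0 → x = 0) (hs : ∀ x y, B x y = B y x)
    (x : V) :
    ∃ x₀ ∈ W, ∃ x₁ : V, (∀ y ∈ W, B y x₁ = 0) ∧ x = x₀ + x₁ := by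
  have hr : B.IsRefl := fun a b h => by rw [hs, h]
  have hd : (B.restrict W).Nondegenerate := by
    have hr' : (B.restrict W).IsRefl := fun a b h => by
      rw [LinearMap.BilinForm.restrict_apply] at h ⊢
      exact hr _ _ h
    refine (LinearMap.IsRefl.nondegenerate_iff_separatingLeft hr').2 ?_
    intro y hy
    exact Subtype.ext (hneg _ (hy y))
  have hc := LinearMap.BilinForm.isCompl_orthogonal_of_restrict_nondegenerate hr hd
  obtain ⟨y, hy, z, hz, h⟩ := Submodule.mem_sup.1 (hc.sup_eq_top ▸ Submodule.mem_top (x := x))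
  exact ⟨y, hy, z, fun w hw => hz w hw, h.symm⟩

/-- An isometry minus the identity is onto the orthogonal complement of its fixed space. -/
lemma exists_fixed_add_sub (hneg : ∀ x, B x x = 0 → x = 0) (hs : ∀ x y, B x y = B y x)
    (hA : ∀ x y, B (A x) (A y) = B x y) (hW : ∀ x, A x = x ↔ x ∈ W) (x : V) :
    ∃ x₀ ∈ W, ∃ z : V, (∀ y ∈ W, B y z = 0) ∧ x = x₀ + (A z - z) := by
  let P : Submodule ℝ V := B.orthogonal W
  have hP : ∀ {v}, v ∈ P ↔ ∀ y ∈ W, B y v = 0 := Iff.rfl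
  have hmap : ∀ v ∈ P, (A - LinearMap.id : V →ₗ[ℝ] V) v ∈ P := by
    intro v hv
    rw [hP] at hv ⊢
    intro y hy
    have h1 : B y (A v) = B y v := by
      conv_lhs => rw [← (hW y).2 hy]
      exact hA _ _
    simp [h1]
  let D : P →ₗ[ℝ] P := (A - LinearMap.id : V →ₗ[ℝ] V).restrict hmap
  -- A kernel vector is fixed by `A`, so it lies in `W` and in its complement. In finite dimension,
  -- injectivity then gives surjectivity.
  have hinj : Function.Injective D := by
    rw [← LinearMap.ker_eq_bot, LinearMap.ker_eq_bot']
    rintro ⟨v, hv⟩ h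
    have h1 : A v - v = 0 := congrArg Subtype.val h
    have h2 := (hW v).1 (sub_eq_zero.1 h1)
    exact Subtype.ext (hneg v (hv v h2))
  obtain ⟨x₀, h0, x₁, h1, rfl⟩ := exists_orthogonal_decomposition (W := W) hneg hs x
  obtain ⟨⟨z, hz⟩, h⟩ := (LinearMap.injective_iff_surjective.1 hinj) ⟨x₁, h1⟩
  have h2 : A z - z = x₁ := congrArg Subtype.val h
  exact ⟨x₀, h0, z, hz, by rw [h2]⟩

/-- The quasi-Poisson bracket at a point of the slice, in terms of the gradients
`a, a', b, b'` and `c, c', d, d'` of two invariant functions. -/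
lemma reduced_bracket_identity (hneg : ∀ x, B x x = 0 → x = 0) (hs : ∀ x y, B x y = B y x)
    (hA : ∀ x y, B (A x) (A y) = B x y) (hW : ∀ x, A x = x ↔ x ∈ W) {R : V → V}
    (hR : ∀ x₀ ∈ W, ∀ z, (∀ y ∈ W, B y z = 0) →
      R (x₀ + (A z - z)) = (1 / 2 : ℝ) • (A z + z))
    {a a' a₀ b b' c c' c₀ d d' : V} (ha : A a' = a) (hc : A c' = c)
    (hab : a - a' + b - b' = 0) (hcd : c - c' + d - d' = 0)
    (ha₀ : a₀ ∈ W) (ha₁ : ∀ y ∈ W, B y a₀ = B y a)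
    (hc₀ : c₀ ∈ W) (hc₁ : ∀ y ∈ W, B y c₀ = B y c) :
    -(B a' d - B b c' + B a d' - B b' c + B a c' - B a' c + B b' d - B b d' - B a d + B b c
        - B b' c' + B a' d') / 2 =
      B c₀ b - B a₀ d + B b' (R d') - B b (R d) := by
  have hAp : ∀ {v}, (∀ y ∈ W, B y v = 0) → ∀ y ∈ W, B y (A v) = 0 := fun {v} hv y hy => by
    conv_lhs => rw [← (hW y).2 hy]
    rw [hA, hv y hy]
  have hinj : ∀ x y, A x = A y → x = y := fun x y h => by
    refine sub_eq_zero.1 (hneg _ ?_)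
    rw [← hA, map_sub, h, sub_self, map_zero]
  -- Invariance reads `b' = b + (A u - u)` with `u = a' - a₀` orthogonal to `W`. Uniqueness of the
  -- decomposition of `b'` therefore gives equal `W`-parts and `z' = z + u`.
  have gen : ∀ {a a' a₀ b b' : V}, A a' = a → a - a' + b - b' = 0 → a₀ ∈ W →
      (∀ y ∈ W, B y a₀ = B y a) → ∃ b₀ ∈ W, ∃ z z' : V, (∀ y ∈ W, B y z = 0) ∧
        (∀ y ∈ W, B y z' = 0) ∧ a = a₀ + A (z' - z) ∧ a' = a₀ + (z' - z) ∧
        b = b₀ + (A z - z) ∧ b' = b₀ + (A z' - z') := by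
    intro a a' a₀ b b' ha hab ha₀ ha₁
    obtain ⟨b₀, hb₀, z, hz, rfl⟩ := exists_fixed_add_sub hneg hs hA hW b
    obtain ⟨b₀', hb₀', z', hz', rfl⟩ := exists_fixed_add_sub hneg hs hA hW b'
    have hu : ∀ y ∈ W, B y (a' - a₀) = 0 := fun y hy => by
      have h1 : B y a' = B y a := by
        rw [← ha]
        conv_rhs => rw [← (hW y).2 hy, hA]
      rw [map_sub, ha₁ y hy, h1, sub_self]
    have hA0 : A (a' - a₀) = a - a₀ := by rw [map_sub, ha, (hW _).2 ha₀]
    have hzu : ∀ y ∈ W, B y (a' - a₀ + z) = 0 := fun y hy => by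
      rw [map_add, hu y hy, hz y hy, add_zero]
    obtain ⟨rfl, h2⟩ := fixed_add_sub_unique hneg hA hW hb₀ hb₀' hzu hz' (by
      rw [map_add, hA0]
      rw [sub_eq_zero] at hab
      rw [← hab]
      abel)
    refine ⟨b₀, hb₀, z, z', hz, hz', ?_, ?_, rfl, rfl⟩
    · rw [← h2, add_sub_cancel_right, hA0]
      abel
    · rw [← h2]
      abel
  obtain ⟨b₀, hb₀, z, z', hz, hz', rfl, rfl, rfl, rfl⟩ := gen ha hab ha₀ ha₁
  obtain ⟨d₀, hd₀, w, w', hw, hw', rfl, rfl, rfl, rfl⟩ := gen hc hcd hc₀ hc₁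
  rw [hR _ hd₀ _ hw, hR _ hd₀ _ hw']
  have sw : ∀ {y v : V}, y ∈ W → (∀ y ∈ W, B y v = 0) → B v y = 0 := fun hy hv => by
    rw [hs, hv _ hy]
  -- Mixed pairings between `W` and its complement vanish, and the isometry `A` cancels where it
  -- occurs on both sides; a polynomial identity remains.
  simp only [map_add, map_sub, map_smul, LinearMap.add_apply, LinearMap.sub_apply, smul_eq_mul,
    hz _ hc₀, hw _ ha₀, hw _ hb₀, hw' _ ha₀, hw' _ hb₀,
    hAp hz _ hc₀, hAp hw _ ha₀, hAp hw _ hb₀,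
    hAp hw' _ ha₀, hAp hw' _ hb₀, sw hc₀ hz, sw hd₀ hz, sw hc₀ hz', sw hd₀ hz',
    sw hc₀ (hAp hz), sw hd₀ (hAp hz), sw hc₀ (hAp hz'), sw hd₀ (hAp hz'), hA]
  rw [hs c₀ b₀]
  ring

end Isometry

/-! ### Maximal tori, their Lie algebras, and the `r`-matrix. -/

section Torus

set_option linter.unusedSectionVars false

variable {E : Type*} [NormedAddCommGroup E] [NormedSpace ℝ E]
  {G : Type*} [TopologicalSpace G] [ChartedSpace E G] [Group G] [LieGroup 𝓘(ℝ, E) ∞ G]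
  [CompleteSpace E] [T2Space G]

variable (E) in
/-- The Lie algebra of a maximal torus, as a subspace. -/
def torusLieAlgebra {G₀ : Subgroup G} (hG₀ : IsMaximalTorus G₀) :
    Submodule ℝ (GroupLieAlgebra 𝓘(ℝ, E) G) where
  carrier := subLieAlgebra G₀
  add_mem' {X Y} hX hY t := by
    rw [lieExp_smul_add_of_commute fun s t => hG₀.1.2.2 _ (hX s) _ (hY t)]
    exact G₀.mul_mem (hX t) (hY t)
  zero_mem' t := by
    have : (lieExp ((0 : ℝ) • (0 : GroupLieAlgebra 𝓘(ℝ, E) G)) : G) = 1 := lieExp_zero_smul _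
    rw [smul_zero] at this ⊢
    rw [this]
    exact G₀.one_mem
  smul_mem' a X hX t := by
    rw [smul_smul]
    exact hX _

lemma mem_torusLieAlgebra {G₀ : Subgroup G} {hG₀ : IsMaximalTorus G₀}
    {X : GroupLieAlgebra 𝓘(ℝ, E) G} :
    X ∈ torusLieAlgebra E hG₀ ↔ X ∈ subLieAlgebra (E := E) G₀ := Iff.rfl

/-- The centralizer is a torus by regularity, and it contains the commutative group `G₀`, which is a
maximal torus. -/
lemma centralizer_eq_of_mem_regularPart {G₀ : Subgroup G} (hG₀ : IsMaximalTorus G₀) {Q : G}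
    (hQ : Q ∈ regularPart G₀) : Subgroup.centralizer {Q} = G₀ := by
  refine hG₀.2 _ hQ.2.1 fun h hh => ?_
  rw [Subgroup.mem_centralizer_singleton_iff]
  exact hG₀.1.2.2 _ hh _ hQ.1

/-- The Lie algebra of `G₀` is the fixed space of `Ad Q` for every regular `Q` in `G₀`. -/
lemma Ad_eq_self_iff {G₀ : Subgroup G} (hG₀ : IsMaximalTorus G₀) {Q : G}
    (hQ : Q ∈ regularPart G₀) (X : GroupLieAlgebra 𝓘(ℝ, E) G) :
    Ad Q X = X ↔ X ∈ torusLieAlgebra E hG₀ := by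
  constructor
  · intro h t
    rw [← centralizer_eq_of_mem_regularPart hG₀ hQ, Subgroup.mem_centralizer_singleton_iff]
    have h2 := conj_lieExp_smul Q X t
    rw [h] at h2
    conv_lhs => rw [h2]
    group
  · intro h
    refine Ad_eq_of_hasVelocityAt ?_ (hasVelocityAt_lieExp X)
    have : (fun t : ℝ => Q * lieExp (t • X) * Q⁻¹) = fun t => lieExp (t • X) := by
      ext t
      rw [hG₀.1.2.2 Q hQ.1 _ (h t), mul_inv_cancel_right]
    rw [this]
    exact hasVelocityAt_lieExp X

variable [FiniteDimensional ℝ (GroupLieAlgebra 𝓘(ℝ, E) G)]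
  {B : LinearMap.BilinForm ℝ (GroupLieAlgebra 𝓘(ℝ, E) G)}

/-- The projection and the inverse in `rMatrix` are arbitrary choices. Uniqueness of the orthogonal
decomposition and injectivity of `Ad Q - id` on the complement pin them down. -/
lemma rMatrix_apply (hneg : ∀ x, B x x = 0 → x = 0)
    (hA : ∀ (g : G) x y, B (Ad g x) (Ad g y) = B x y) {G₀ : Subgroup G} (hG₀ : IsMaximalTorus G₀)
    {Q : G} (hQ : Q ∈ regularPart G₀) {X₀ Z : GroupLieAlgebra 𝓘(ℝ, E) G}
    (hX : X₀ ∈ torusLieAlgebra E hG₀) (hZ : ∀ y ∈ torusLieAlgebra E hG₀, B y Z = 0) :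
    rMatrix B G₀ Q (X₀ + (Ad Q Z - Z)) = (1 / 2 : ℝ) • (Ad Q Z + Z) := by
  have hW := Ad_eq_self_iff (E := E) hG₀ hQ
  have hZ' : Ad Q Z - Z ∈ perp B G₀ := by
    intro y hy
    have h1 : B y (Ad Q Z) = B y Z := by
      conv_lhs => rw [← (hW y).2 hy]
      exact hA _ _ _
    rw [map_sub, h1, sub_self]
  have hp : perpPart B G₀ (X₀ + (Ad Q Z - Z)) = Ad Q Z - Z := by
    obtain ⟨h1, h2⟩ := Classical.epsilon_spec (p := fun Y => Y ∈ perp B G₀ ∧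
      X₀ + (Ad Q Z - Z) - Y ∈ subLieAlgebra (E := E) G₀) ⟨_, hZ', by rw [add_sub_cancel_right]; exact hX⟩
    change perpPart B G₀ (X₀ + (Ad Q Z - Z)) ∈ _ at h1
    change X₀ + (Ad Q Z - Z) - perpPart B G₀ (X₀ + (Ad Q Z - Z)) ∈ _ at h2
    set Y := perpPart B G₀ (X₀ + (Ad Q Z - Z))
    have h3 : Ad Q Z - Z - Y ∈ torusLieAlgebra E hG₀ := by
      have := (torusLieAlgebra E hG₀).sub_mem (mem_torusLieAlgebra.2 h2) hX
      convert this using 1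
      abel
    refine (sub_eq_zero.1 (hneg _ ?_)).symm
    rw [map_sub (B _), hZ' _ h3, h1 _ h3, sub_zero]
  have hmem : ∃ Y ∈ perp B G₀, Ad Q Y - Y = perpPart B G₀ (X₀ + (Ad Q Z - Z)) :=
    ⟨Z, hZ, hp.symm⟩
  have h1 := Function.invFunOn_mem hmem
  have h2 := Function.invFunOn_eq hmem
  simp only [rMatrix]
  set Y := Function.invFunOn (fun Z => Ad Q Z - Z) (perp B G₀)
    (perpPart B G₀ (X₀ + (Ad Q Z - Z)))
  have h3 : Y = Z := (fixed_add_sub_unique (A := (AdEquiv E Q).toLinearMap) (B := B) hneg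
    (fun x y => hA Q x y) hW (x₀ := 0) (y₀ := 0) (Submodule.zero_mem _) (Submodule.zero_mem _)
    h1 hZ (congrArg (0 + ·) (h2.trans hp))).2
  rw [h3]

/-- By anisotropy at most one vector of `W` represents `φ`, so the choice in `gradOn` must return
it. -/
lemma gradOn_eq (hneg : ∀ x, B x x = 0 → x = 0)
    {W : Submodule ℝ (GroupLieAlgebra 𝓘(ℝ, E) G)} {S : Set (GroupLieAlgebra 𝓘(ℝ, E) G)}
    (hS : S = W) {φ : GroupLieAlgebra 𝓘(ℝ, E) G → ℝ} {v : GroupLieAlgebra 𝓘(ℝ, E) G}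
    (hv : v ∈ W) (h : ∀ X ∈ W, B X v = φ X) : gradOn B S φ = v := by
  subst hS
  obtain ⟨h1, h2⟩ := Classical.epsilon_spec (p := fun v => v ∈ (W : Set _) ∧
    ∀ X ∈ (W : Set (GroupLieAlgebra 𝓘(ℝ, E) G)), B X v = φ X) ⟨v, hv, h⟩
  exact gradient_unique hneg h1 hv fun X hX => (h2 X hX).trans (h X hX).symm

end Torus

/-! ### Velocities in charts. -/

section ChartVelocity

variable {E : Type*} [NormedAddCommGroup E] [NormedSpace ℝ E]
  {M : Type*} [TopologicalSpace M] [ChartedSpace E M]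

/-- In the preferred chart at `x`, the coordinates of a tangent vector at `x` are the vector. -/
lemma HasVelocityAt.hasDerivAt_extChartAt {c : ℝ → M} {t : ℝ} {x : M} {v : TangentSpace 𝓘(ℝ, E) x}
    (h : HasVelocityAt 𝓘(ℝ, E) c t x v) :
    HasDerivAt (F := E) (fun s => extChartAt 𝓘(ℝ, E) x (c s)) v t := by
  obtain ⟨rfl, L, h, rfl⟩ := h
  have h2 := h.2
  simp only [mfld_simps] at h2
  have h3 : HasFDerivAt (𝕜 := ℝ) (F := E) (fun s => extChartAt 𝓘(ℝ, E) (c t) (c s)) L t :=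
    h2.hasFDerivAt univ_mem
  exact h3.hasDerivAt

end ChartVelocity

/-! ### Quantitative linear algebra for a definite form. -/

section LinearEstimates

variable {E : Type*} [NormedAddCommGroup E] [NormedSpace ℝ E] [FiniteDimensional ℝ E]

lemma exists_pos_le_on_sphere (b : E →L[ℝ] E →L[ℝ] ℝ) (hneg : ∀ x, x ≠ 0 → b x x < 0)
    {r : ℝ} (hr : 0 < r) : ∃ δ > 0, ∀ u : E, ‖u‖ = r → δ ≤ -b u u := by
  have := FiniteDimensional.proper_real E
  obtain ⟨δ, hδ, h⟩ := (isCompact_sphere (0 : E) r).exists_forall_le' (f := fun u => -b u u)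
    (a := 0) (by fun_prop) (fun u hu => by
      have : u ≠ 0 := by
        rintro rfl
        simp at hu
        exact hr.ne hu
      linarith [hneg u this])
  exact ⟨δ, hδ, fun u hu => h u (by simpa using hu)⟩

/-- A vector that is almost orthogonal to the fixed space of an isometry and almost fixed is
zero. -/
lemma exists_eps_eq_zero (b : E →L[ℝ] E →L[ℝ] ℝ) (hneg : ∀ x, x ≠ 0 → b x x < 0)
    (A : E →L[ℝ] E) (W : Submodule ℝ E) (hW : ∀ x, A x = x → x ∈ W) :
    ∃ ε > 0, ∀ u : E, (∀ x ∈ W, |b x u| ≤ ε * ‖u‖ * ‖x‖) → ‖A u - u‖ ≤ ε * ‖u‖ → u = 0 := by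
  -- The map `u ↦ (b(·, u)|_W, A u - u)` is injective, hence bounded below in finite dimension with
  -- some constant `K`. The choice `ε = 1 / (2K)` turns the two estimates into `‖u‖ ≤ ‖u‖ / 2`.
  let T : E →L[ℝ] (W →L[ℝ] ℝ) := (ContinuousLinearMap.precomp ℝ W.subtypeL).comp b.flip
  let L : E →L[ℝ] (W →L[ℝ] ℝ) × E := T.prod (A - ContinuousLinearMap.id ℝ E)
  obtain ⟨K, hK, hL⟩ := LinearMap.exists_antilipschitzWith (𝕜 := ℝ) (E := E)
    (F := (W →L[ℝ] ℝ) × E) L.toLinearMap (by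
    rw [LinearMap.ker_eq_bot']
    intro u hu
    have h1 : T u = 0 := congrArg Prod.fst hu
    have h2 : A u - u = 0 := congrArg Prod.snd hu
    by_contra h0
    have h3 : b u u = 0 := DFunLike.congr_fun h1 ⟨u, hW u (sub_eq_zero.1 h2)⟩
    exact (hneg u h0).ne h3)
  have hK' : (0 : ℝ) < K := hK
  refine ⟨1 / (2 * K), by positivity, fun u h1 h2 => ?_⟩
  have h3 : ‖T u‖ ≤ 1 / (2 * K) * ‖u‖ :=
    ContinuousLinearMap.opNorm_le_bound _ (by positivity) fun x => h1 x x.2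
  have h4 : ‖L u‖ ≤ 1 / (2 * K) * ‖u‖ := max_le h3 h2
  have h5 : ‖u‖ ≤ K * ‖L u‖ := by
    have h := hL.le_mul_dist u 0
    have h' : dist (L u) (L 0) = ‖L u‖ :=
      (congrArg (dist (L u)) L.map_zero).trans (dist_zero_right (L u))
    rw [dist_zero_right] at h
    exact h.trans_eq (congrArg (fun r : ℝ => (K : ℝ) * r) h')
  have h6 : K * ‖L u‖ ≤ ‖u‖ / 2 := by
    calc (K : ℝ) * ‖L u‖ ≤ K * (1 / (2 * K) * ‖u‖) := by gcongr
      _ = ‖u‖ / 2 := by field_simp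
  exact norm_le_zero_iff.1 (by linarith)

end LinearEstimates

/-! ### Multiplication and conjugation in charts near the identity. -/

section Charts

set_option linter.unusedSectionVars false

variable {E : Type*} [NormedAddCommGroup E] [NormedSpace ℝ E]
  {G : Type*} [TopologicalSpace G] [ChartedSpace E G] [Group G] [LieGroup 𝓘(ℝ, E) ∞ G]

lemma contMDiffAt_extChartAt_symm (x : G) :
    ContMDiffAt 𝓘(ℝ, E) 𝓘(ℝ, E) ∞ (extChartAt 𝓘(ℝ, E) x).symm (extChartAt 𝓘(ℝ, E) x x) :=
  (contMDiffOn_extChartAt_symm x).contMDiffAt (extChartAt_target_mem_nhds x)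

lemma contDiffAt_chart_mul :
    ContDiffAt ℝ ∞ (fun p : E × E => extChartAt 𝓘(ℝ, E) (1 : G)
      ((extChartAt 𝓘(ℝ, E) (1 : G)).symm p.1 * (extChartAt 𝓘(ℝ, E) (1 : G)).symm p.2))
      (extChartAt 𝓘(ℝ, E) (1 : G) 1, extChartAt 𝓘(ℝ, E) (1 : G) 1) := by
  rw [← contMDiffAt_iff_contDiffAt]
  have h1 := (contMDiffAt_extChartAt_symm (E := E) (1 : G)).comp
    (extChartAt 𝓘(ℝ, E) (1 : G) 1, extChartAt 𝓘(ℝ, E) (1 : G) 1)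
    (contDiff_fst (𝕜 := ℝ) (E := E) (F := E)).contMDiff.contMDiffAt
  have h2 := (contMDiffAt_extChartAt_symm (E := E) (1 : G)).comp
    (extChartAt 𝓘(ℝ, E) (1 : G) 1, extChartAt 𝓘(ℝ, E) (1 : G) 1)
    (contDiff_snd (𝕜 := ℝ) (E := E) (F := E)).contMDiff.contMDiffAt
  exact ContMDiffAt.comp_of_eq (contMDiffAt_extChartAt (I := 𝓘(ℝ, E)) (x := (1 : G)))
    (h1.mul h2) (by simp)

lemma contDiffAt_chart_conj (Q : G) :
    ContDiffAt ℝ ∞ (fun p : E × E => extChartAt 𝓘(ℝ, E) (1 : G)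
      ((extChartAt 𝓘(ℝ, E) Q).symm p.1 * (extChartAt 𝓘(ℝ, E) (1 : G)).symm p.2 *
        ((extChartAt 𝓘(ℝ, E) Q).symm p.1)⁻¹))
      (extChartAt 𝓘(ℝ, E) Q Q, extChartAt 𝓘(ℝ, E) (1 : G) 1) := by
  rw [← contMDiffAt_iff_contDiffAt]
  have h1 := (contMDiffAt_extChartAt_symm (E := E) Q).comp
    (extChartAt 𝓘(ℝ, E) Q Q, extChartAt 𝓘(ℝ, E) (1 : G) 1)
    (contDiff_fst (𝕜 := ℝ) (E := E) (F := E)).contMDiff.contMDiffAt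
  have h2 := (contMDiffAt_extChartAt_symm (E := E) (1 : G)).comp
    (extChartAt 𝓘(ℝ, E) Q Q, extChartAt 𝓘(ℝ, E) (1 : G) 1)
    (contDiff_snd (𝕜 := ℝ) (E := E) (F := E)).contMDiff.contMDiffAt
  exact ContMDiffAt.comp_of_eq (contMDiffAt_extChartAt (I := 𝓘(ℝ, E)) (x := (1 : G)))
    ((h1.mul h2).mul h1.inv) (by simp)

variable [CompleteSpace E] [T2Space G]

/-- For `h` near the identity, the velocity of `h * exp (t X)` in the chart at the identity is a
linear function of `X` that is close to `X`. -/
lemma exists_chart_velocity_mul_lieExp {ε : ℝ} (hε : 0 < ε) :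
    ∀ᶠ h : G in 𝓝 1, ∃ D : E →L[ℝ] E, ‖D - ContinuousLinearMap.id ℝ E‖ ≤ ε ∧
      ∀ X : GroupLieAlgebra 𝓘(ℝ, E) G, HasDerivAt
        (fun t : ℝ => extChartAt 𝓘(ℝ, E) (1 : G) (h * lieExp (t • X))) (D X) 0 := by
  set χ := extChartAt 𝓘(ℝ, E) (1 : G) with hχ
  let Θ : E × E → E := fun p => χ (χ.symm p.1 * χ.symm p.2)
  have hΘ : ContDiffAt ℝ ∞ Θ (χ 1, χ 1) := contDiffAt_chart_mul
  let D : E × E → E →L[ℝ] E := fun p => (fderiv ℝ Θ p).comp (ContinuousLinearMap.inr ℝ E E)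
  have hχ1 : ContinuousAt χ 1 := continuousAt_extChartAt 1
  have key : ∀ h ∈ χ.source, DifferentiableAt ℝ Θ (χ h, χ 1) →
      ∀ X : GroupLieAlgebra 𝓘(ℝ, E) G,
        HasDerivAt (fun t : ℝ => χ (h * lieExp (t • X))) (D (χ h, χ 1) X) 0 := by
    intro h hh hd X
    have h1 := (hasVelocityAt_lieExp X).hasDerivAt_extChartAt
    have h2 : HasDerivAt (fun t : ℝ => (χ h, χ (lieExp (t • X)))) ((0 : E), (X : E)) 0 :=
      (hasDerivAt_const (0 : ℝ) (χ h)).prodMk h1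
    have h3 : HasDerivAt (fun t : ℝ => Θ (χ h, χ (lieExp (t • X)))) (D (χ h, χ 1) X) 0 := by
      have hd' : HasFDerivAt Θ (fderiv ℝ Θ (χ h, χ 1))
          ((fun t : ℝ => (χ h, χ (lieExp (t • X)))) 0) := by
        have : (lieExp ((0 : ℝ) • X) : G) = 1 := lieExp_zero_smul X
        simp only [this]
        exact hd.hasFDerivAt
      exact hd'.comp_hasDerivAt (0 : ℝ) h2
    refine h3.congr_of_eventuallyEq ?_
    have h4 : ∀ᶠ t : ℝ in 𝓝 0, lieExp (t • X) ∈ χ.source :=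
      (hasVelocityAt_lieExp X).tendsto (extChartAt_source_mem_nhds (I := 𝓘(ℝ, E)) (1 : G))
    filter_upwards [h4] with t ht
    simp only [Θ, χ.left_inv hh, χ.left_inv ht]
  -- At `h = 1` both sides are the chart velocity of `exp (t X)`; continuity of the derivative then
  -- gives closeness to the identity for nearby `h`.
  have hD1 : D (χ 1, χ 1) = ContinuousLinearMap.id ℝ E := by
    ext X
    have h1 := key 1 (mem_extChartAt_source 1) (hΘ.differentiableAt (by simp)) X
    have h2 := (hasVelocityAt_lieExp (G := G) X).hasDerivAt_extChartAt
    simp only [one_mul] at h1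
    exact h1.unique h2
  have hDc : Tendsto (fun h : G => D (χ h, χ 1)) (𝓝 1) (𝓝 (D (χ 1, χ 1))) := by
    have h1 : ContinuousAt (fderiv ℝ Θ) (χ 1, χ 1) :=
      (hΘ.fderiv_right (m := 0) (by simp)).continuousAt
    have h2 : ContinuousAt D (χ 1, χ 1) := h1.clm_comp continuousAt_const
    exact h2.tendsto.comp (hχ1.prodMk continuousAt_const)
  have hdiff : ∀ᶠ p in 𝓝 (χ 1, χ 1), DifferentiableAt ℝ Θ p := by
    have := (hΘ.of_le (m := 1) (by simp)).eventually (by simp)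
    exact this.mono fun p hp => hp.differentiableAt (by simp)
  have hdiff' : ∀ᶠ h in 𝓝 (1 : G), DifferentiableAt ℝ Θ (χ h, χ 1) :=
    (hχ1.prodMk (continuousAt_const (y := χ 1))).eventually hdiff
  rw [hD1] at hDc
  have hsmall := hDc.eventually (Metric.closedBall_mem_nhds _ hε)
  filter_upwards [hdiff', hsmall, extChartAt_source_mem_nhds (I := 𝓘(ℝ, E)) (1 : G)]
    with h h1 h2 h3
  exact ⟨D (χ h, χ 1), by simpa [dist_eq_norm] using h2, key h h3 h1⟩

/-- Near the identity, a conjugation by an element near `Q` is given by `Ad Q`, up to a small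
error. -/
lemma eventually_chart_conj (Q : G) (A : E →L[ℝ] E)
    (hA : ∀ X : GroupLieAlgebra 𝓘(ℝ, E) G, A X = Ad Q X) {ε : ℝ} (hε : 0 < ε) :
    ∀ᶠ p : G × G in 𝓝 (1, Q),
      ‖extChartAt 𝓘(ℝ, E) (1 : G) (p.2 * p.1 * p.2⁻¹) - extChartAt 𝓘(ℝ, E) (1 : G) 1
        - A (extChartAt 𝓘(ℝ, E) (1 : G) p.1 - extChartAt 𝓘(ℝ, E) (1 : G) 1)‖ ≤
      ε * ‖extChartAt 𝓘(ℝ, E) (1 : G) p.1 - extChartAt 𝓘(ℝ, E) (1 : G) 1‖ := by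
  set χ := extChartAt 𝓘(ℝ, E) (1 : G) with hχ
  set ξ := extChartAt 𝓘(ℝ, E) Q with hξ
  let Ψ : E × E → E := fun p => χ (ξ.symm p.1 * χ.symm p.2 * (ξ.symm p.1)⁻¹)
  have hΨ : ContDiffAt ℝ ∞ Ψ (ξ Q, χ 1) := contDiffAt_chart_conj Q
  have hstrict := hΨ.hasStrictFDerivAt (by simp)
  have hχ1 : ContinuousAt χ 1 := continuousAt_extChartAt 1
  have hξQ : ContinuousAt ξ Q := continuousAt_extChartAt Q
  have hD : ∀ X : E, fderiv ℝ Ψ (ξ Q, χ 1) (0, X) = A X := by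
    intro X
    have h1 := (hasVelocityAt_lieExp (G := G) X).hasDerivAt_extChartAt
    have h2 : HasDerivAt (fun t : ℝ => (ξ Q, χ (lieExp (t • (X : GroupLieAlgebra 𝓘(ℝ, E) G)))))
        ((0 : E), (X : E)) 0 :=
      (hasDerivAt_const (0 : ℝ) (ξ Q)).prodMk h1
    have h3 : HasDerivAt
        (fun t : ℝ => Ψ (ξ Q, χ (lieExp (t • (X : GroupLieAlgebra 𝓘(ℝ, E) G)))))
        (fderiv ℝ Ψ (ξ Q, χ 1) (0, X)) 0 := by
      have hd' : HasFDerivAt Ψ (fderiv ℝ Ψ (ξ Q, χ 1))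
          ((fun t : ℝ => (ξ Q, χ (lieExp (t • (X : GroupLieAlgebra 𝓘(ℝ, E) G))))) 0) := by
        have : (lieExp ((0 : ℝ) • (X : GroupLieAlgebra 𝓘(ℝ, E) G)) : G) = 1 := lieExp_zero_smul _
        simp only [this]
        exact hstrict.hasFDerivAt
      exact hd'.comp_hasDerivAt (0 : ℝ) h2
    have h5 := ((hasVelocityAt_lieExp (G := G) X).conj Q).hasDerivAt_extChartAt
    refine ((h3.congr_of_eventuallyEq ?_).unique h5).trans (hA X).symm
    have h4 : ∀ᶠ t : ℝ in 𝓝 0, (lieExp (t • (X : GroupLieAlgebra 𝓘(ℝ, E) G)) : G) ∈ χ.source :=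
      (hasVelocityAt_lieExp X).tendsto (extChartAt_source_mem_nhds (I := 𝓘(ℝ, E)) (1 : G))
    filter_upwards [h4] with t ht
    simp only [Ψ, χ.left_inv ht, ξ.left_inv (mem_extChartAt_source (I := 𝓘(ℝ, E)) Q)]
    rfl
  -- Strict differentiability is needed: it compares the points over `(q, x)` and `(q, 1)` with an
  -- error proportional to the distance of `x` from 1, uniformly in `q` near `Q`.
  have hO := hstrict.isLittleO.def hε
  have hT : Tendsto (fun p : G × G => ((ξ p.2, χ p.1), (ξ p.2, χ 1))) (𝓝 (1, Q))
      (𝓝 ((ξ Q, χ 1), (ξ Q, χ 1))) := by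
    have h1 : Tendsto (fun p : G × G => χ p.1) (𝓝 (1, Q)) (𝓝 (χ 1)) :=
      hχ1.tendsto.comp continuous_fst.continuousAt
    have h2 : Tendsto (fun p : G × G => ξ p.2) (𝓝 (1, Q)) (𝓝 (ξ Q)) :=
      hξQ.tendsto.comp continuous_snd.continuousAt
    exact (h2.prodMk_nhds h1).prodMk_nhds (h2.prodMk_nhds tendsto_const_nhds)
  have hs1 : ∀ᶠ p : G × G in 𝓝 (1, Q), p.1 ∈ χ.source :=
    continuous_fst.continuousAt (extChartAt_source_mem_nhds (I := 𝓘(ℝ, E)) (1 : G))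
  have hs2 : ∀ᶠ p : G × G in 𝓝 (1, Q), p.2 ∈ ξ.source :=
    continuous_snd.continuousAt (extChartAt_source_mem_nhds (I := 𝓘(ℝ, E)) Q)
  filter_upwards [hT.eventually hO, hs1, hs2] with p h1 h2 h3
  have h4 : χ.symm (χ 1) = 1 := extChartAt_to_inv (I := 𝓘(ℝ, E)) (1 : G)
  simpa [Ψ, χ.left_inv h2, ξ.left_inv h3, h4, hD] using h1

end Charts

/-! ### Openness of the regular elements in a maximal torus. -/

section Openness

set_option linter.unusedSectionVars false

variable {E : Type*} [NormedAddCommGroup E] [NormedSpace ℝ E] [FiniteDimensional ℝ E]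
  {G : Type*} [TopologicalSpace G] [ChartedSpace E G] [Group G] [LieGroup 𝓘(ℝ, E) ∞ G]
  [CompleteSpace E] [T2Space G]

/-- In every coset `h G₀` with `h` near the identity there is an element near the identity whose
coordinates are orthogonal, with respect to `b`, to the tangent space of the coset. -/
lemma exists_coset_critical (b : E →L[ℝ] E →L[ℝ] ℝ) (hneg : ∀ x, x ≠ 0 → b x x < 0)
    (hsymm : ∀ x y, b x y = b y x) {G₀ : Subgroup G} (hG₀ : IsCompact (G₀ : Set G))
    {U : Set G} (hU : U ∈ 𝓝 (1 : G)) :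
    ∀ᶠ h : G in 𝓝 1, ∃ k ∈ G₀, h * k ∈ U ∧
      ∀ X ∈ subLieAlgebra (E := E) G₀, ∀ v : E, HasDerivAt
        (fun t : ℝ => extChartAt 𝓘(ℝ, E) (1 : G) (h * k * lieExp (t • X))) v 0 →
        b (extChartAt 𝓘(ℝ, E) (1 : G) (h * k) - extChartAt 𝓘(ℝ, E) (1 : G) 1) v = 0 := by
  set χ := extChartAt 𝓘(ℝ, E) (1 : G) with hχ
  have := FiniteDimensional.proper_real E
  have : IsTopologicalGroup G := topologicalGroup_of_lieGroup 𝓘(ℝ, E) ∞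
  have hχ1 : ContinuousAt χ 1 := continuousAt_extChartAt 1
  have hsrc : χ.source ∈ 𝓝 (1 : G) := extChartAt_source_mem_nhds 1
  have hsymm1 : χ.symm (χ 1) = 1 := extChartAt_to_inv 1
  obtain ⟨r, hr, hball⟩ : ∃ r > 0, Metric.closedBall (χ 1) r ⊆ χ.target ∩ χ.symm ⁻¹' U := by
    refine Metric.nhds_basis_closedBall.mem_iff.1 (inter_mem (extChartAt_target_mem_nhds 1) ?_)
    have : ContinuousAt χ.symm (χ 1) := continuousAt_extChartAt_symm 1
    exact this (by rwa [hsymm1])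
  let C : Set G := χ.symm '' Metric.closedBall (χ 1) r
  have hCmem : ∀ {x}, x ∈ C ↔ x ∈ χ.source ∧ ‖χ x - χ 1‖ ≤ r := by
    intro x
    constructor
    · rintro ⟨y, hy, rfl⟩
      have := (hball hy).1
      refine ⟨χ.map_target this, ?_⟩
      rw [χ.right_inv this]
      simpa [dist_eq_norm] using hy
    · rintro ⟨hx, hxr⟩
      exact ⟨χ x, by simpa [dist_eq_norm] using hxr, χ.left_inv hx⟩
  have hCcomp : IsCompact C := (isCompact_closedBall (χ 1) r).image_of_continuousOn
    ((continuousOn_extChartAt_symm 1).mono fun y hy => (hball hy).1)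
  -- The function `f` below is at least `δ` on the boundary sphere of the chart ball and less than
  -- `δ` at `h`, so its minimum over the part of the coset in the ball is interior.
  obtain ⟨δ, hδ, hδr⟩ := exists_pos_le_on_sphere b hneg hr
  let f : G → ℝ := fun x => -b (χ x - χ 1) (χ x - χ 1)
  have hfc : ∀ x ∈ χ.source, ContinuousAt f x := by
    intro x hx
    have : ContinuousAt χ x := continuousAt_extChartAt' hx
    fun_prop
  have hf1 : ∀ᶠ h in 𝓝 (1 : G), f h < δ :=
    (hfc 1 (mem_extChartAt_source 1)).eventually (gt_mem_nhds (by simpa [f] using hδ))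
  have hC1 : ∀ᶠ h in 𝓝 (1 : G), h ∈ C := by
    have h1 : ∀ᶠ h in 𝓝 (1 : G), χ h ∈ Metric.closedBall (χ 1) r :=
      hχ1 (Metric.closedBall_mem_nhds _ hr)
    filter_upwards [h1, hsrc] with h h1 h2
    exact hCmem.2 ⟨h2, by simpa [dist_eq_norm] using h1⟩
  filter_upwards [hf1, hC1] with h hfh hCh
  have hScomp : IsCompact ((G₀ : Set G) ∩ (fun k => h * k) ⁻¹' C) :=
    hG₀.inter_right (hCcomp.isClosed.preimage (continuous_const_mul h))
  obtain ⟨k, ⟨hk, hkC⟩, hmin⟩ := hScomp.exists_isMinOn ⟨1, G₀.one_mem, by simpa using hCh⟩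
    (f := fun k => f (h * k)) (fun k hk => ((hfc _ (hCmem.1 hk.2).1).comp
      (continuous_const_mul h).continuousAt).continuousWithinAt)
  obtain ⟨hks, hkr⟩ := hCmem.1 hkC
  have hlt : ‖χ (h * k) - χ 1‖ < r := by
    refine lt_of_le_of_ne hkr fun heq => ?_
    have h1 : f (h * k) ≤ f (h * 1) := hmin ⟨G₀.one_mem, by simpa using hCh⟩
    rw [mul_one] at h1
    exact absurd (hδr _ heq) (not_le.2 (h1.trans_lt hfh))
  refine ⟨k, hk, ?_, fun X hX v hv => ?_⟩
  · have := (hball (show χ (h * k) ∈ Metric.closedBall (χ 1) r by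
      simpa [dist_eq_norm] using hkr)).2
    rwa [mem_preimage, χ.left_inv hks] at this
  · have hT : Tendsto (fun t : ℝ => h * k * lieExp (t • X)) (𝓝 0) (𝓝 (h * k)) :=
      ((hasVelocityAt_lieExp X).const_mul (h * k)).tendsto
    have h0 : (lieExp ((0 : ℝ) • X) : G) = 1 := lieExp_zero_smul X
    have hev : ∀ᶠ t : ℝ in 𝓝 0, h * k * lieExp (t • X) ∈ C := by
      have h1 : ContinuousAt χ (h * k) := continuousAt_extChartAt' hks
      have h2 : ∀ᶠ x in 𝓝 (h * k), ‖χ x - χ 1‖ < r :=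
        (h1.sub continuousAt_const).norm.eventually (gt_mem_nhds hlt)
      have h3 : ∀ᶠ x in 𝓝 (h * k), x ∈ χ.source := extChartAt_source_mem_nhds' hks
      exact hT.eventually ((h2.and h3).mono fun x hx => hCmem.2 ⟨hx.2, hx.1.le⟩)
    -- The curve stays in the coset and, for small `t`, in the ball, so vanishing of the derivative
    -- is the orthogonality sought.
    have hloc : IsLocalMin (fun t : ℝ => f (h * k * lieExp (t • X))) 0 := by
      filter_upwards [hev] with t ht
      rw [h0, mul_one, mul_assoc]
      rw [mul_assoc] at ht
      exact hmin ⟨G₀.mul_mem hk (hX t), ht⟩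
    have hu := hv.sub_const (χ 1)
    have hd := ((b.hasFDerivAt.comp_hasDerivAt (0 : ℝ) hu).clm_apply hu).neg
    have hz := hloc.hasDerivAt_eq_zero hd
    simp only [Function.comp_apply, h0, mul_one] at hz
    rw [hsymm v] at hz
    linarith

/-- Elements of the torus near the regular element `Q` commute with no element near the identity
outside of the torus. -/
lemma eventually_mem_of_commute (b : E →L[ℝ] E →L[ℝ] ℝ) (hneg : ∀ x, x ≠ 0 → b x x < 0)
    (hsymm : ∀ x y, b x y = b y x) {G₀ : Subgroup G} (hG₀ : IsMaximalTorus G₀)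
    {Q : G} (hQ : Q ∈ regularPart G₀) :
    ∀ᶠ p : G × G in 𝓝 (1, Q), p.2 ∈ G₀ → p.1 * p.2 = p.2 * p.1 → p.1 ∈ G₀ := by
  let A : E →L[ℝ] E := mfderiv 𝓘(ℝ, E) 𝓘(ℝ, E) (fun h : G => Q * h * Q⁻¹) 1
  have hA : ∀ X : GroupLieAlgebra 𝓘(ℝ, E) G, A X = Ad Q X := fun X => rfl
  let W : Submodule ℝ E := torusLieAlgebra E hG₀
  obtain ⟨ε, hε, hW⟩ := exists_eps_eq_zero b hneg A W fun x hx => (Ad_eq_self_iff hG₀ hQ x).1 hx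
  -- The tolerance is divided so that the error in the chart velocities, after pairing by `b`, is at
  -- most `ε`; adding 1 avoids division by zero.
  have hε' : 0 < ε / (‖b‖ + 1) := by positivity
  have h1 := exists_chart_velocity_mul_lieExp (E := E) (G := G) hε'
  have h2 := eventually_chart_conj Q A hA hε
  rw [nhds_prod_eq] at h2 ⊢
  obtain ⟨pa, hpa, pb, hpb, h2⟩ := eventually_prod_iff.1 h2
  have h3 := exists_coset_critical b hneg hsymm hG₀.1.1
    (inter_mem (inter_mem h1 hpa) (extChartAt_source_mem_nhds (I := 𝓘(ℝ, E)) (1 : G)))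
  refine eventually_prod_iff.2 ⟨_, h3, _, hpb, ?_⟩
  rintro h ⟨k, hk, ⟨⟨⟨D, hD, hDX⟩, hka⟩, hks⟩, hcrit⟩ q hq hqG hcomm
  set u : E := extChartAt 𝓘(ℝ, E) (1 : G) (h * k) - extChartAt 𝓘(ℝ, E) (1 : G) 1 with hu
  -- Since `k` and `q` lie in the torus, `h * k` still commutes with `q`; so its coordinate `u` is
  -- almost fixed by `Ad Q`.
  have hq1 : q * (h * k) * q⁻¹ = h * k := by
    rw [mul_inv_eq_iff_eq_mul, ← mul_assoc, ← hcomm, mul_assoc, mul_assoc, hG₀.1.2.2 q hqG k hk]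
  have h4 := h2 hka hq
  simp only [hq1, ← hu] at h4
  have hu0 : u = 0 := by
    refine hW u (fun x hx => ?_) (by rwa [norm_sub_rev])
    have h5 : b u (D x) = 0 := hcrit x hx _ (hDX x)
    have h6 : b x u = -b u ((D - ContinuousLinearMap.id ℝ E) x) := by
      simp [h5, hsymm x u]
    rw [h6, abs_neg, ← Real.norm_eq_abs]
    calc ‖b u ((D - ContinuousLinearMap.id ℝ E) x)‖
        ≤ ‖b‖ * ‖u‖ * ‖(D - ContinuousLinearMap.id ℝ E) x‖ := b.le_opNorm₂ _ _
      _ ≤ (‖b‖ + 1) * ‖u‖ * (ε / (‖b‖ + 1) * ‖x‖) := by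
          gcongr
          · linarith
          · exact (ContinuousLinearMap.le_opNorm _ _).trans (by gcongr)
      _ = ε * ‖u‖ * ‖x‖ := by field_simp
  have h7 : h * k = 1 := (extChartAt 𝓘(ℝ, E) (1 : G)).injOn hks (mem_extChartAt_source 1)
    (sub_eq_zero.1 hu0)
  rw [eq_inv_of_mul_eq_one_left h7]
  exact G₀.inv_mem hk

variable [CompactSpace G]

/-- The regular part of a maximal torus is open in the torus. -/
lemma eventually_mem_regularPart (b : E →L[ℝ] E →L[ℝ] ℝ) (hneg : ∀ x, x ≠ 0 → b x x < 0)
    (hsymm : ∀ x y, b x y = b y x) {G₀ : Subgroup G} (hG₀ : IsMaximalTorus G₀)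
    {Q : G} (hQ : Q ∈ regularPart G₀) : ∀ᶠ q in 𝓝 Q, q ∈ G₀ → q ∈ regularPart G₀ := by
  have : IsTopologicalGroup G := topologicalGroup_of_lieGroup 𝓘(ℝ, E) ∞
  have key : ∀ᶠ q in 𝓝 Q, ∀ h ∈ (univ : Set G), q ∈ G₀ → h * q = q * h → h ∈ G₀ := by
    refine isCompact_univ.eventually_forall_of_forall_eventually
      (P := fun q h => q ∈ G₀ → h * q = q * h → h ∈ G₀) fun h _ => ?_
    -- For `h` in the torus, translating by `h⁻¹` reduces to elements near 1. For `h` outside it,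
    -- `h` fails to commute with `Q`, and failing to commute is an open condition.
    by_cases hh : h ∈ G₀
    · have h1 := eventually_mem_of_commute (E := E) b hneg hsymm hG₀ hQ
      have h2 : Tendsto (fun p : G × G => (p.2 * h⁻¹, p.1)) (𝓝 (Q, h)) (𝓝 (1, Q)) := by
        have : ContinuousAt (fun p : G × G => (p.2 * h⁻¹, p.1)) (Q, h) := by fun_prop
        simpa [ContinuousAt] using this
      filter_upwards [h2.eventually h1] with p hp hpG hcomm
      have h3 : p.2 * h⁻¹ ∈ G₀ := by
        refine hp hpG ?_
        have h4 := hG₀.1.2.2 _ (G₀.inv_mem hh) _ hpG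
        rw [mul_assoc, h4, ← mul_assoc, hcomm, mul_assoc]
      simpa using G₀.mul_mem h3 hh
    · have h1 : h * Q ≠ Q * h := fun h1 => hh <| by
        rw [← centralizer_eq_of_mem_regularPart hG₀ hQ]
        exact Subgroup.mem_centralizer_singleton_iff.2 h1
      have h2 : ∀ᶠ p : G × G in 𝓝 (Q, h), p.2 * p.1 ≠ p.1 * p.2 :=
        (isOpen_ne_fun (by fun_prop) (by fun_prop)).mem_nhds h1
      exact h2.mono fun p hp _ h3 => absurd h3 hp
  filter_upwards [key] with q hq hqG
  refine ⟨hqG, ?_⟩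
  have : Subgroup.centralizer {q} = G₀ := by
    refine le_antisymm (fun h hh => hq h (mem_univ h) hqG
      (Subgroup.mem_centralizer_singleton_iff.1 hh)) fun h hh => ?_
    exact Subgroup.mem_centralizer_singleton_iff.2 (hG₀.1.2.2 h hh q hqG)
  rw [IsRegular, this]
  exact hG₀

end Openness

/-! ### Consequences of a basis with `B (e a) (e b) = -δ`. -/

section OrthonormalBasis

variable {V : Type*} [AddCommGroup V] [Module ℝ V] {B : LinearMap.BilinForm ℝ V}
  {ι : Type*} [Fintype ι] [DecidableEq ι] {e : Module.Basis ι ℝ V}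

lemma bilin_eq_neg_sum (he : ∀ a b, B (e a) (e b) = if a = b then -1 else 0) (x y : V) :
    B x y = -∑ a, e.repr x a * e.repr y a := by
  conv_lhs => rw [← e.sum_repr x, ← e.sum_repr y]
  simp [he, -Module.Basis.sum_repr, mul_comm]

lemma bilin_comm (he : ∀ a b, B (e a) (e b) = if a = b then -1 else 0) (x y : V) :
    B x y = B y x := by
  rw [bilin_eq_neg_sum he, bilin_eq_neg_sum he]
  simp only [mul_comm]

lemma eq_zero_of_bilin_self (he : ∀ a b, B (e a) (e b) = if a = b then -1 else 0) {x : V}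
    (h : 0 ≤ B x x) : x = 0 := by
  rw [bilin_eq_neg_sum he] at h
  have h1 : ∀ a ∈ Finset.univ, 0 ≤ e.repr x a * e.repr x a := fun a _ => mul_self_nonneg _
  have h2 : ∑ a, e.repr x a * e.repr x a = 0 :=
    le_antisymm (by linarith) (Finset.sum_nonneg h1)
  refine e.repr.map_eq_zero_iff.1 (Finsupp.ext fun a => ?_)
  simpa using (Finset.sum_eq_zero_iff_of_nonneg h1).1 h2 a (Finset.mem_univ a)

lemma bilin_basis (he : ∀ a b, B (e a) (e b) = if a = b then -1 else 0) (a : ι) (x : V) :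
    B (e a) x = -e.repr x a := by
  rw [bilin_eq_neg_sum he]
  simp [Finsupp.single_apply]

/-- This evaluates each term of the bivector on a pair of differentials. The sign comes from the
normalisation of the basis and explains the overall minus in `qpBracket_eq`. -/
lemma sum_bilin_mul_bilin (he : ∀ a b, B (e a) (e b) = if a = b then -1 else 0) (x y : V) :
    ∑ a, B (e a) x * B (e a) y = -B x y := by
  simp [bilin_basis he, bilin_eq_neg_sum he x y]

lemma exists_gradient (he : ∀ a b, B (e a) (e b) = if a = b then -1 else 0) {φ : V → ℝ}
    (hφ : IsLinearMap ℝ φ) : ∃ v, ∀ x, φ x = B x v := by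
  refine ⟨-∑ a, φ (e a) • e a, fun x => ?_⟩
  have h : φ x = hφ.mk' φ (∑ a, e.repr x a • e a) := by rw [e.sum_repr]; rfl
  rw [h, bilin_eq_neg_sum he]
  simp [Finsupp.single_apply, -Module.Basis.sum_repr]

end OrthonormalBasis

/-! ### Gradients on the double and the quasi-Poisson bracket in terms of them. -/

section Gradients

set_option linter.unusedSectionVars false

variable {E : Type*} [NormedAddCommGroup E] [NormedSpace ℝ E]
  {G : Type*} [TopologicalSpace G] [ChartedSpace E G] [Group G] [LieGroup 𝓘(ℝ, E) ∞ G]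
  {B : LinearMap.BilinForm ℝ (GroupLieAlgebra 𝓘(ℝ, E) G)}

lemma inFst_add (p : G × G) (v w : TangentSpace 𝓘(ℝ, E) p.1) :
    inFst p (v + w) = inFst p v + inFst p w :=
  Prod.ext rfl (add_zero (0 : E)).symm

lemma inFst_smul (p : G × G) (r : ℝ) (v : TangentSpace 𝓘(ℝ, E) p.1) :
    inFst p (r • v) = r • inFst p v :=
  Prod.ext rfl (smul_zero (A := E) r).symm

lemma inSnd_add (p : G × G) (v w : TangentSpace 𝓘(ℝ, E) p.2) :
    inSnd p (v + w) = inSnd p v + inSnd p w :=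
  Prod.ext (add_zero (0 : E)).symm rfl

lemma inSnd_smul (p : G × G) (r : ℝ) (v : TangentSpace 𝓘(ℝ, E) p.2) :
    inSnd p (r • v) = r • inSnd p v :=
  Prod.ext (smul_zero (A := E) r).symm rfl

lemma rightInvariantVectorField_add (X Y : GroupLieAlgebra 𝓘(ℝ, E) G) (g : G) :
    rightInvariantVectorField (X + Y) g =
      rightInvariantVectorField X g + rightInvariantVectorField Y g :=
  (mfderiv 𝓘(ℝ, E) 𝓘(ℝ, E) (fun h : G => h * g) 1).map_add X Y

lemma rightInvariantVectorField_smul (r : ℝ) (X : GroupLieAlgebra 𝓘(ℝ, E) G) (g : G) :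
    rightInvariantVectorField (r • X) g = r • rightInvariantVectorField X g :=
  (mfderiv 𝓘(ℝ, E) 𝓘(ℝ, E) (fun h : G => h * g) 1).map_smul r X

lemma isLinearMap_R1 (f : G × G → ℝ) (p : G × G) :
    IsLinearMap ℝ fun X => differential (E := E) f p (R1 X p) where
  map_add X Y := by rw [R1, rightInvariantVectorField_add, inFst_add, map_add]; rfl
  map_smul r X := by rw [R1, rightInvariantVectorField_smul, inFst_smul, map_smul]; rfl

lemma isLinearMap_R2 (f : G × G → ℝ) (p : G × G) :
    IsLinearMap ℝ fun X => differential (E := E) f p (R2 X p) where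
  map_add X Y := by rw [R2, rightInvariantVectorField_add, inSnd_add, map_add]; rfl
  map_smul r X := by rw [R2, rightInvariantVectorField_smul, inSnd_smul, map_smul]; rfl

lemma isLinearMap_L1 (f : G × G → ℝ) (p : G × G) :
    IsLinearMap ℝ fun X => differential (E := E) f p (L1 X p) where
  map_add X Y := by rw [L1, mulInvariantVectorField_add, Pi.add_apply, inFst_add, map_add]; rfl
  map_smul r X := by
    rw [L1, mulInvariantVectorField_smul, Pi.smul_apply, inFst_smul, map_smul]; rfl

lemma isLinearMap_L2 (f : G × G → ℝ) (p : G × G) :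
    IsLinearMap ℝ fun X => differential (E := E) f p (L2 X p) where
  map_add X Y := by rw [L2, mulInvariantVectorField_add, Pi.add_apply, inSnd_add, map_add]; rfl
  map_smul r X := by
    rw [L2, mulInvariantVectorField_smul, Pi.smul_apply, inSnd_smul, map_smul]; rfl

/-- `a, a', b, b'` are the derivatives `∇₁f, ∇₁'f, ∇₂f, ∇₂'f` at `p`. -/
structure IsGradient (B : LinearMap.BilinForm ℝ (GroupLieAlgebra 𝓘(ℝ, E) G)) (f : G × G → ℝ)
    (p : G × G) (a a' b b' : GroupLieAlgebra 𝓘(ℝ, E) G) : Prop where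
  r1 : ∀ X, differential f p (R1 X p) = B X a
  l1 : ∀ X, differential f p (L1 X p) = B X a'
  r2 : ∀ X, differential f p (R2 X p) = B X b
  l2 : ∀ X, differential f p (L2 X p) = B X b'

lemma exists_isGradient {ι : Type*} [Fintype ι] [DecidableEq ι]
    {e : Module.Basis ι ℝ (GroupLieAlgebra 𝓘(ℝ, E) G)}
    (he : ∀ a b, B (e a) (e b) = if a = b then -1 else 0) (f : G × G → ℝ) (p : G × G) :
    ∃ a a' b b', IsGradient B f p a a' b b' := by
  obtain ⟨a, ha⟩ := exists_gradient he (isLinearMap_R1 f p)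
  obtain ⟨a', ha'⟩ := exists_gradient he (isLinearMap_L1 f p)
  obtain ⟨b, hb⟩ := exists_gradient he (isLinearMap_R2 f p)
  obtain ⟨b', hb'⟩ := exists_gradient he (isLinearMap_L2 f p)
  exact ⟨a, a', b, b', ha, ha', hb, hb'⟩

lemma mul'_map_wedge {V : Type*} [AddCommGroup V] [Module ℝ V] (f h : V →ₗ[ℝ] ℝ) (v w : V) :
    LinearMap.mul' ℝ ℝ (TensorProduct.map f h (wedge v w)) = f v * h w - f w * h v := by
  simp [wedge]

lemma qpBracket_eq {ι : Type*} [Fintype ι] [DecidableEq ι]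
    {e : Module.Basis ι ℝ (GroupLieAlgebra 𝓘(ℝ, E) G)}
    (he : ∀ a b, B (e a) (e b) = if a = b then -1 else 0) {f h : G × G → ℝ} {p : G × G}
    {a a' b b' c c' d d' : GroupLieAlgebra 𝓘(ℝ, E) G}
    (hf : IsGradient B f p a a' b b') (hh : IsGradient B h p c c' d d') :
    qpBracket e f h p =
      -(B a' d - B b c' + B a d' - B b' c + B a c' - B a' c + B b' d - B b d' - B a d + B b c
        - B b' c' + B a' d') / 2 := by
  have hs := sum_bilin_mul_bilin he
  simp only [qpBracket, bivector, map_smul, map_sum, map_add, map_sub, mul'_map_wedge, hf.r1,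
    hf.r2, hf.l1, hf.l2, hh.r1, hh.r2, hh.l1, hh.l2, Finset.sum_add_distrib,
    Finset.sum_sub_distrib, hs, smul_eq_mul]
  ring

variable [CompleteSpace E] [T2Space G] {f : G × G → ℝ} {p : G × G}
  {a a' b b' : GroupLieAlgebra 𝓘(ℝ, E) G}

lemma hasVelocityAt_R1 (X : GroupLieAlgebra 𝓘(ℝ, E) G) (p : G × G) :
    HasVelocityAt (𝓘(ℝ, E).prod 𝓘(ℝ, E)) (fun t : ℝ => (lieExp (t • X) * p.1, p.2)) 0 p (R1 X p) :=
  ((hasVelocityAt_lieExp X).mul_const p.1).prodMk (hasVelocityAt_const p.2 0)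

lemma hasVelocityAt_L1 (X : GroupLieAlgebra 𝓘(ℝ, E) G) (p : G × G) :
    HasVelocityAt (𝓘(ℝ, E).prod 𝓘(ℝ, E)) (fun t : ℝ => (p.1 * lieExp (t • X), p.2)) 0 p (L1 X p) :=
  ((hasVelocityAt_lieExp X).const_mul p.1).prodMk (hasVelocityAt_const p.2 0)

lemma hasVelocityAt_R2 (X : GroupLieAlgebra 𝓘(ℝ, E) G) (p : G × G) :
    HasVelocityAt (𝓘(ℝ, E).prod 𝓘(ℝ, E)) (fun t : ℝ => (p.1, lieExp (t • X) * p.2)) 0 p (R2 X p) :=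
  (hasVelocityAt_const p.1 0).prodMk ((hasVelocityAt_lieExp X).mul_const p.2)

lemma hasVelocityAt_L2 (X : GroupLieAlgebra 𝓘(ℝ, E) G) (p : G × G) :
    HasVelocityAt (𝓘(ℝ, E).prod 𝓘(ℝ, E)) (fun t : ℝ => (p.1, p.2 * lieExp (t • X))) 0 p (L2 X p) :=
  (hasVelocityAt_const p.1 0).prodMk ((hasVelocityAt_lieExp X).const_mul p.2)

lemma deriv_eq_differential {c : ℝ → G × G} {v : TangentSpace (𝓘(ℝ, E).prod 𝓘(ℝ, E)) p}
    (hc : HasVelocityAt (𝓘(ℝ, E).prod 𝓘(ℝ, E)) c 0 p v)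
    (hf : MDifferentiableAt (𝓘(ℝ, E).prod 𝓘(ℝ, E)) 𝓘(ℝ, ℝ) f p) :
    deriv (fun t => f (c t)) 0 = differential f p v :=
  (hc.hasDerivAt_comp hf).deriv

/-- At `g`, the left-invariant field of `Y` equals the right-invariant field of `Ad g Y`; invariance
of the form transfers this to gradients. -/
lemma IsGradient.ad_fst (hneg : ∀ x, B x x = 0 → x = 0)
    (hA : ∀ (g : G) x y, B (Ad g x) (Ad g y) = B x y) (h : IsGradient B f p a a' b b') :
    Ad p.1 a' = a := by
  refine gradient_unique (W := ⊤) hneg trivial trivial fun X _ => ?_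
  obtain ⟨Y, rfl⟩ := (AdEquiv E p.1).surjective X
  rw [AdEquiv_apply, hA, ← h.l1, ← h.r1, L1, R1, mulInvariantVectorField_eq_right]

lemma IsGradient.ad_snd (hneg : ∀ x, B x x = 0 → x = 0)
    (hA : ∀ (g : G) x y, B (Ad g x) (Ad g y) = B x y) (h : IsGradient B f p a a' b b') :
    Ad p.2 b' = b := by
  refine gradient_unique (W := ⊤) hneg trivial trivial fun X _ => ?_
  obtain ⟨Y, rfl⟩ := (AdEquiv E p.2).surjective X
  rw [AdEquiv_apply, hA, ← h.l2, ← h.r2, L2, R2, mulInvariantVectorField_eq_right]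

/-- The infinitesimal form of the invariance under simultaneous conjugation. -/
lemma IsGradient.invariance (hneg : ∀ x, B x x = 0 → x = 0)
    (h : IsGradient B f p a a' b b')
    (hf : MDifferentiableAt (𝓘(ℝ, E).prod 𝓘(ℝ, E)) 𝓘(ℝ, ℝ) f p)
    (hinv : ∀ η : G, f (η * p.1 * η⁻¹, η * p.2 * η⁻¹) = f p) : a - a' + b - b' = 0 := by
  refine gradient_unique (W := ⊤) hneg trivial trivial fun X _ => ?_
  -- Differentiate `f` along the conjugation orbit of `p` under `exp (t X)`, on which it is
  -- constant.
  have hv := ((hasVelocityAt_lieExp X).mul_mul (hasVelocityAt_lieExp (-X)) p.1).prodMk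
    ((hasVelocityAt_lieExp X).mul_mul (hasVelocityAt_lieExp (-X)) p.2)
  have h1 := deriv_eq_differential hv hf
  have h2 : (fun t : ℝ => f (lieExp (t • X) * p.1 * lieExp (t • -X),
      lieExp (t • X) * p.2 * lieExp (t • -X))) = fun _ => f p := by
    ext t
    rw [smul_neg, ← neg_smul, lieExp_neg_smul, hinv]
  rw [h2, deriv_const] at h1
  have h3 : (Prod.mk (α := TangentSpace 𝓘(ℝ, E) p.1) (β := TangentSpace 𝓘(ℝ, E) p.2)
      (rightInvariantVectorField X p.1 + mulInvariantVectorField (-X) p.1)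
      (rightInvariantVectorField X p.2 + mulInvariantVectorField (-X) p.2) :
        TangentSpace (𝓘(ℝ, E).prod 𝓘(ℝ, E)) p) =
      R1 X p + L1 (-X) p + (R2 X p + L2 (-X) p) := by
    rw [R1, L1, R2, L2, ← inFst_add, ← inSnd_add]
    exact Prod.ext (add_zero (_ : E)).symm (zero_add (_ : E)).symm
  have h4 := h1.trans (congrArg (differential f p) h3)
  rw [map_add, map_add, map_add, h.r1, h.l1, h.r2, h.l2] at h4
  simp only [map_sub, map_add, map_neg, LinearMap.neg_apply, map_zero] at h4 ⊢
  linarith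

end Gradients

/-! ### The bracket on the two slices. -/

section Reduction

set_option linter.unusedSectionVars false

variable {E : Type*} [NormedAddCommGroup E] [NormedSpace ℝ E] [FiniteDimensional ℝ E]
  [CompleteSpace E]
  {G : Type*} [TopologicalSpace G] [ChartedSpace E G] [Group G] [LieGroup 𝓘(ℝ, E) ∞ G]
  [T2Space G] [CompactSpace G]
  {B : LinearMap.BilinForm ℝ (GroupLieAlgebra 𝓘(ℝ, E) G)}
  {ι : Type*} [Fintype ι] [DecidableEq ι]
  {e : Module.Basis ι ℝ (GroupLieAlgebra 𝓘(ℝ, E) G)}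
  {G₀ : Subgroup G}

instance : FiniteDimensional ℝ (GroupLieAlgebra 𝓘(ℝ, E) G) :=
  inferInstanceAs (FiniteDimensional ℝ E)

/-- A function and its extension agree only on the slice, so their derivatives in torus directions
can be compared only if the curve stays regular for small times. -/
lemma eventually_lieExp_smul_mul_mem (he : ∀ a b, B (e a) (e b) = if a = b then -1 else 0)
    (hG₀ : IsMaximalTorus G₀) {Q : G} (hQ : Q ∈ regularPart G₀)
    {X : GroupLieAlgebra 𝓘(ℝ, E) G} (hX : X ∈ torusLieAlgebra E hG₀) :
    ∀ᶠ t : ℝ in 𝓝 0, lieExp (t • X) * Q ∈ regularPart G₀ := by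
  let b₀ : E →ₗ[ℝ] E →ₗ[ℝ] ℝ := B
  let b : E →L[ℝ] E →L[ℝ] ℝ := LinearMap.toContinuousLinearMap
    ((LinearMap.toContinuousLinearMap (𝕜 := ℝ) (E := E) (F' := ℝ)).toLinearMap ∘ₗ b₀)
  have h1 := eventually_mem_regularPart b
    (fun x hx => not_le.1 fun h => hx (eq_zero_of_bilin_self he h))
    (fun x y => bilin_comm he x y) hG₀ hQ
  have h2 := ((hasVelocityAt_lieExp X).mul_const Q).tendsto.eventually h1
  exact h2.mono fun t ht => ht (G₀.mul_mem (hX t) hQ.1)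

lemma rMatrix_add_sub (he : ∀ a b, B (e a) (e b) = if a = b then -1 else 0)
    (hA : ∀ (g : G) x y, B (Ad g x) (Ad g y) = B x y)
    (hG₀ : IsMaximalTorus G₀) {Q : G} (hQ : Q ∈ regularPart G₀) :
    ∀ x₀ ∈ torusLieAlgebra E hG₀, ∀ z, (∀ y ∈ torusLieAlgebra E hG₀, B y z = 0) →
      rMatrix B G₀ Q (x₀ + ((AdEquiv E Q).toLinearMap z - z)) =
        (1 / 2 : ℝ) • ((AdEquiv E Q).toLinearMap z + z) :=
  fun _ hx _ hz => rMatrix_apply (fun _ h => eq_zero_of_bilin_self he h.ge) hA hG₀ hQ hx hz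

/-- The quasi-Poisson bracket on the slice in terms of the restricted functions, first variable
regular. -/
lemma qpBracket_eq_of_regular_fst (he : ∀ a b, B (e a) (e b) = if a = b then -1 else 0)
    (hA : ∀ (g : G) x y, B (Ad g x) (Ad g y) = B x y) (hG₀ : IsMaximalTorus G₀)
    {Ft Ht F H : G × G → ℝ}
    (hFt : IsSmoothInvariantOn E (regFst G) Ft) (hHt : IsSmoothInvariantOn E (regFst G) Ht)
    (hF : EqOn F Ft (sliceFst G₀)) (hH : EqOn H Ht (sliceFst G₀))
    {Q : G} (hQ : Q ∈ regularPart G₀) (g : G) :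
    qpBracket e Ft Ht (Q, g) =
      B (nabla1 B (subLieAlgebra G₀) H (Q, g)) (nabla2 B univ F (Q, g))
        - B (nabla1 B (subLieAlgebra G₀) F (Q, g)) (nabla2 B univ H (Q, g))
        + B (nabla2' B F (Q, g)) (rMatrix B G₀ Q (nabla2' B H (Q, g)))
        - B (nabla2 B univ F (Q, g)) (rMatrix B G₀ Q (nabla2 B univ H (Q, g))) := by
  have hneg : ∀ x, B x x = 0 → x = 0 := fun _ h => eq_zero_of_bilin_self he h.ge
  have hs := bilin_comm he
  have grad : ∀ {Ft F : G × G → ℝ}, IsSmoothInvariantOn E (regFst G) Ft →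
      EqOn F Ft (sliceFst G₀) → ∃ a a' b b' a₀, IsGradient B Ft (Q, g) a a' b b' ∧
        a - a' + b - b' = 0 ∧ a₀ ∈ torusLieAlgebra E hG₀ ∧
        (∀ y ∈ torusLieAlgebra E hG₀, B y a₀ = B y a) ∧
        nabla1 B (subLieAlgebra G₀) F (Q, g) = a₀ ∧ nabla2 B univ F (Q, g) = b ∧
        nabla2' B F (Q, g) = b' := by
    intro Ft F hFt hF
    have hd := (hFt.1 (Q, g) hQ.2).mdifferentiableAt (by simp)
    obtain ⟨a, a', b, b', h⟩ := exists_isGradient he Ft (Q, g)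
    obtain ⟨a₀, ha₀, a₁, ha₁, rfl⟩ :=
      exists_orthogonal_decomposition (W := torusLieAlgebra E hG₀) hneg hs a
    refine ⟨_, _, _, _, a₀, h, h.invariance hneg hd fun η => hFt.2 η _ hQ.2, ha₀,
      fun y hy => by rw [map_add, ha₁ y hy, add_zero], ?_, ?_, ?_⟩
    · refine gradOn_eq (W := torusLieAlgebra E hG₀) hneg rfl ha₀ fun X hX => ?_
      have h1 : (fun t : ℝ => F (lieExp (t • X) * Q, g)) =ᶠ[𝓝 0]
          fun t => Ft (lieExp (t • X) * Q, g) :=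
        (eventually_lieExp_smul_mul_mem he hG₀ hQ hX).mono fun t ht => hF ht
      rw [h1.deriv_eq, deriv_eq_differential (hasVelocityAt_R1 X (Q, g)) hd, h.r1, map_add,
        ha₁ X hX, add_zero]
    · refine gradOn_eq (W := ⊤) hneg rfl trivial fun X _ => ?_
      have h1 : ∀ t : ℝ, F (Q, lieExp (t • X) * g) = Ft (Q, lieExp (t • X) * g) :=
        fun t => hF hQ
      simp only [h1]
      rw [deriv_eq_differential (hasVelocityAt_R2 X (Q, g)) hd, h.r2]
    · refine gradOn_eq (W := ⊤) hneg rfl trivial fun X _ => ?_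
      have h1 : ∀ t : ℝ, F (Q, g * lieExp (t • X)) = Ft (Q, g * lieExp (t • X)) :=
        fun t => hF hQ
      simp only [h1]
      rw [deriv_eq_differential (hasVelocityAt_L2 X (Q, g)) hd, h.l2]
  obtain ⟨a, a', b, b', a₀, hf, hab, ha₀, ha₁, e1, e2, e3⟩ := grad hFt hF
  obtain ⟨c, c', d, d', c₀, hh, hcd, hc₀, hc₁, e4, e5, e6⟩ := grad hHt hH
  rw [e1, e2, e3, e4, e5, e6, qpBracket_eq he hf hh]
  exact reduced_bracket_identity (A := (AdEquiv E Q).toLinearMap) hneg hs (hA Q)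
    (Ad_eq_self_iff hG₀ hQ) (rMatrix_add_sub he hA hG₀ hQ) (hf.ad_fst hneg hA)
    (hh.ad_fst hneg hA) hab hcd ha₀ ha₁ hc₀ hc₁

/-- The quasi-Poisson bracket on the slice in terms of the restricted functions, second variable
regular. -/
lemma qpBracket_eq_of_regular_snd (he : ∀ a b, B (e a) (e b) = if a = b then -1 else 0)
    (hA : ∀ (g : G) x y, B (Ad g x) (Ad g y) = B x y) (hG₀ : IsMaximalTorus G₀)
    {Ft Ht F H : G × G → ℝ}
    (hFt : IsSmoothInvariantOn E (regSnd G) Ft) (hHt : IsSmoothInvariantOn E (regSnd G) Ht)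
    (hF : EqOn F Ft (sliceSnd G₀)) (hH : EqOn H Ht (sliceSnd G₀))
    {Q : G} (hQ : Q ∈ regularPart G₀) (g : G) :
    qpBracket e Ft Ht (g, Q) =
      B (nabla2 B (subLieAlgebra G₀) F (g, Q)) (nabla1 B univ H (g, Q))
        - B (nabla2 B (subLieAlgebra G₀) H (g, Q)) (nabla1 B univ F (g, Q))
        + B (nabla1 B univ F (g, Q)) (rMatrix B G₀ Q (nabla1 B univ H (g, Q)))
        - B (nabla1' B F (g, Q)) (rMatrix B G₀ Q (nabla1' B H (g, Q))) := by
  have hneg : ∀ x, B x x = 0 → x = 0 := fun _ h => eq_zero_of_bilin_self he h.ge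
  have hs := bilin_comm he
  have grad : ∀ {Ft F : G × G → ℝ}, IsSmoothInvariantOn E (regSnd G) Ft →
      EqOn F Ft (sliceSnd G₀) → ∃ a a' b b' b₀, IsGradient B Ft (g, Q) a a' b b' ∧
        a - a' + b - b' = 0 ∧ b₀ ∈ torusLieAlgebra E hG₀ ∧
        (∀ y ∈ torusLieAlgebra E hG₀, B y b₀ = B y b) ∧
        nabla2 B (subLieAlgebra G₀) F (g, Q) = b₀ ∧ nabla1 B univ F (g, Q) = a ∧
        nabla1' B F (g, Q) = a' := by
    intro Ft F hFt hF
    have hd := (hFt.1 (g, Q) hQ.2).mdifferentiableAt (by simp)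
    obtain ⟨a, a', b, b', h⟩ := exists_isGradient he Ft (g, Q)
    obtain ⟨b₀, hb₀, b₁, hb₁, rfl⟩ :=
      exists_orthogonal_decomposition (W := torusLieAlgebra E hG₀) hneg hs b
    refine ⟨_, _, _, _, b₀, h, h.invariance hneg hd fun η => hFt.2 η _ hQ.2, hb₀,
      fun y hy => by rw [map_add, hb₁ y hy, add_zero], ?_, ?_, ?_⟩
    · refine gradOn_eq (W := torusLieAlgebra E hG₀) hneg rfl hb₀ fun X hX => ?_
      have h1 : (fun t : ℝ => F (g, lieExp (t • X) * Q)) =ᶠ[𝓝 0]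
          fun t => Ft (g, lieExp (t • X) * Q) :=
        (eventually_lieExp_smul_mul_mem he hG₀ hQ hX).mono fun t ht => hF ht
      rw [h1.deriv_eq, deriv_eq_differential (hasVelocityAt_R2 X (g, Q)) hd, h.r2, map_add,
        hb₁ X hX, add_zero]
    · refine gradOn_eq (W := ⊤) hneg rfl trivial fun X _ => ?_
      have h1 : ∀ t : ℝ, F (lieExp (t • X) * g, Q) = Ft (lieExp (t • X) * g, Q) :=
        fun t => hF hQ
      simp only [h1]
      rw [deriv_eq_differential (hasVelocityAt_R1 X (g, Q)) hd, h.r1]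
    · refine gradOn_eq (W := ⊤) hneg rfl trivial fun X _ => ?_
      have h1 : ∀ t : ℝ, F (g * lieExp (t • X), Q) = Ft (g * lieExp (t • X), Q) :=
        fun t => hF hQ
      simp only [h1]
      rw [deriv_eq_differential (hasVelocityAt_L1 X (g, Q)) hd, h.l1]
  obtain ⟨a, a', b, b', b₀, hf, hab, hb₀, hb₁, e1, e2, e3⟩ := grad hFt hF
  obtain ⟨c, c', d, d', d₀, hh, hcd, hd₀, hd₁, e4, e5, e6⟩ := grad hHt hH
  rw [e1, e2, e3, e4, e5, e6, qpBracket_eq he hf hh]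
  -- Interchanging the two factors reverses the sign of the bivector and preserves the invariance
  -- relation. The identity with the roles of the factors exchanged is therefore the negative of the
  -- goal.
  have key := reduced_bracket_identity (A := (AdEquiv E Q).toLinearMap) hneg hs (hA Q)
    (Ad_eq_self_iff hG₀ hQ) (rMatrix_add_sub he hA hG₀ hQ) (hf.ad_snd hneg hA)
    (hh.ad_snd hneg hA) (b := a) (b' := a') (d := c) (d' := c')
    (by rw [← hab]; abel) (by rw [← hcd]; abel) hb₀ hb₁ hd₀ hd₁
  obtain rfl : b' = a - a' + b := (sub_eq_zero.1 hab).symm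
  obtain rfl : d' = c - c' + d := (sub_eq_zero.1 hcd).symm
  simp only [map_add, map_sub, LinearMap.add_apply, LinearMap.sub_apply] at key ⊢
  linarith

/-- Once some extensions exist, the pair chosen in `reducedBracket` consists of invariant extensions
as well, though not necessarily the given ones. -/
lemma exists_reducedBracket_eq (D S : Set (G × G)) {Ft Ht F H : G × G → ℝ}
    (hFt : IsSmoothInvariantOn E D Ft) (hHt : IsSmoothInvariantOn E D Ht)
    (hF : EqOn F Ft S) (hH : EqOn H Ht S) :
    ∃ K L : G × G → ℝ, IsSmoothInvariantOn E D K ∧ IsSmoothInvariantOn E D L ∧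
      EqOn F K S ∧ EqOn H L S ∧ ∀ p, reducedBracket e D S F H p = qpBracket e K L p := by
  obtain ⟨h1, h2, h3, h4⟩ := Classical.epsilon_spec
    (p := fun K : (G × G → ℝ) × (G × G → ℝ) =>
      IsSmoothInvariantOn E D K.1 ∧ IsSmoothInvariantOn E D K.2 ∧ EqOn F K.1 S ∧ EqOn H K.2 S)
    ⟨(Ft, Ht), hFt, hHt, hF, hH⟩
  exact ⟨_, _, h1, h2, h3, h4, fun p => rfl⟩

end Reduction

end

end QPDouble

/-! ### The main theorem. -/

open QPDouble in
theorem theorem4p3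
    {E : Type*} [NormedAddCommGroup E] [NormedSpace ℝ E] [FiniteDimensional ℝ E] [CompleteSpace E]
    {G : Type*} [TopologicalSpace G] [ChartedSpace E G] [Group G] [LieGroup 𝓘(ℝ, E) ∞ G]
    [T2Space G] [CompactSpace G] [ConnectedSpace G] [SimplyConnectedSpace G]
    [LieAlgebra.IsSimple ℝ (GroupLieAlgebra 𝓘(ℝ, E) G)]
    (B : LinearMap.BilinForm ℝ (GroupLieAlgebra 𝓘(ℝ, E) G))
    (hB : ∃ c : ℝ, 0 < c ∧ B = c • killingForm ℝ (GroupLieAlgebra 𝓘(ℝ, E) G))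
    {ι : Type*} [Fintype ι] [DecidableEq ι]
    (e : Module.Basis ι ℝ (GroupLieAlgebra 𝓘(ℝ, E) G))
    (he : ∀ a b, B (e a) (e b) = if a = b then -1 else 0)
    (G₀ : Subgroup G) (hG₀ : IsMaximalTorus G₀) :
    (∀ Ft Ht F H : G × G → ℝ,
      IsSmoothInvariantOn E (regFst G) Ft → IsSmoothInvariantOn E (regFst G) Ht →
      Set.EqOn F Ft (sliceFst G₀) → Set.EqOn H Ht (sliceFst G₀) →
      ∀ Q ∈ regularPart G₀, ∀ g : G,
        reducedBracket e (regFst G) (sliceFst G₀) F H (Q, g) = qpBracket e Ft Ht (Q, g) ∧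
        reducedBracket e (regFst G) (sliceFst G₀) F H (Q, g) =
          B (nabla1 B (subLieAlgebra G₀) H (Q, g))
              (nabla2 B Set.univ F (Q, g))
            - B (nabla1 B (subLieAlgebra G₀) F (Q, g))
              (nabla2 B Set.univ H (Q, g))
            + B (nabla2' B F (Q, g))
              (rMatrix B G₀ Q (nabla2' B H (Q, g)))
            - B (nabla2 B Set.univ F (Q, g))
              (rMatrix B G₀ Q (nabla2 B Set.univ H (Q, g)))) ∧
    (∀ Ft Ht F H : G × G → ℝ,
      IsSmoothInvariantOn E (regSnd G) Ft → IsSmoothInvariantOn E (regSnd G) Ht →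
      Set.EqOn F Ft (sliceSnd G₀) → Set.EqOn H Ht (sliceSnd G₀) →
      ∀ Q ∈ regularPart G₀, ∀ g : G,
        reducedBracket e (regSnd G) (sliceSnd G₀) F H (g, Q) = qpBracket e Ft Ht (g, Q) ∧
        reducedBracket e (regSnd G) (sliceSnd G₀) F H (g, Q) =
          B (nabla2 B (subLieAlgebra G₀) F (g, Q))
              (nabla1 B Set.univ H (g, Q))
            - B (nabla2 B (subLieAlgebra G₀) H (g, Q))
              (nabla1 B Set.univ F (g, Q))
            + B (nabla1 B Set.univ F (g, Q))
              (rMatrix B G₀ Q (nabla1 B Set.univ H (g, Q)))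
            - B (nabla1' B F (g, Q))
              (rMatrix B G₀ Q (nabla1' B H (g, Q)))) := by
  have hA : ∀ (g : G) x y, B (Ad g x) (Ad g y) = B x y := by
    obtain ⟨c, -, rfl⟩ := hB
    intro g x y
    simp only [LinearMap.smul_apply, killingForm_Ad]
  constructor
  · intro Ft Ht F H hFt hHt hF hH Q hQ g
    obtain ⟨K, L, hK, hL, hFK, hHL, hred⟩ :=
      exists_reducedBracket_eq (e := e) (regFst G) (sliceFst G₀) hFt hHt hF hH
    -- The given and the chosen extensions yield the same right side, which mentions only `F` and
    -- `H`; this proves well-definedness and the formula together.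
    have h1 := qpBracket_eq_of_regular_fst he hA hG₀ hFt hHt hF hH hQ g
    have h2 := qpBracket_eq_of_regular_fst he hA hG₀ hK hL hFK hHL hQ g
    exact ⟨(hred _).trans (h2.trans h1.symm), (hred _).trans h2⟩
  · intro Ft Ht F H hFt hHt hF hH Q hQ g
    obtain ⟨K, L, hK, hL, hFK, hHL, hred⟩ :=
      exists_reducedBracket_eq (e := e) (regSnd G) (sliceSnd G₀) hFt hHt hF hH
    have h1 := qpBracket_eq_of_regular_snd he hA hG₀ hFt hHt hF hH hQ g
    have h2 := qpBracket_eq_of_regular_snd he hA hG₀ hK hL hFK hHL hQ g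
    exact ⟨(hred _).trans (h2.trans h1.symm), (hred _).trans h2⟩
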